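/- Let $n\ge 1$ and let $\mathbb{B}^n\subset\mathbb{C}^n$ be the open Euclidean unit ball, with $h(z,w)=1-\langle z,w\rangle=1-\sum_j z_j\overline{w_j}$ and genus $p=n+1$. Let $v$ be Lebesgue measure on $\mathbb{B}^n$ normalized by $v(\mathbb{B}^n)=1$. For real $\lambda>p-1=n$ let $dv_\lambda(z)=c_\lambda(1-|z|^2)^{\lambda-p}\,dv(z)$, where $c_\lambda>0$ is chosen such that $v_\lambda(\mathbb{B}^n)=1$, let $K_\lambda(z,w)=h(z,w)^{-\lambda}$ (principal power) be the reproducing kernel of the space of holomorphic functions in $L^2(\mathbb{B}^n,v_\lambda)$, and let $k^\lambda_w=K_\lambda(\cdot,w)/\|K_\lambda(\cdot,w)\|_{L^2(v_\lambda)}$. For $f\in L^\infty(\mathbb{B}^n)$ put $$\mathcal{B}_\lambda(f)(z)=\int_{\mathbb{B}^n} f(w)\,|k^\lambda_z(w)|^2\,dv_\lambda(w),\qquad \mathrm{MO}^\lambda(f)(z)=\mathcal{B}_\lambda(|f|^2)(z)-|\mathcal{B}_\lambda(f)(z)|^2,$$ $$\|f\|_{\mathrm{BMO}^\lambda}=\sup_{z\in\mathbb{B}^n}\sqrt{\mathrm{MO}^\lambda(f)(z)}.$$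 Let $\beta$ be the Bergman distance on $\mathbb{B}^n$, i.e. the distance induced by the metric tensor $g_{ij}(z)=\frac{\partial^2}{\partial z_i\partial\overline{z}_j}\log K_p(z,z)$: $\beta(x,y)$ is the infimum of $\int_0^1\big(\sum_{i,j}g_{ij}(\gamma(t))\gamma_i'(t)\overline{\gamma_j'(t)}\big)^{1/2}dt$ over all $C^1$ curves $\gamma:[0,1]\to\mathbb{B}^n$ from $x$ to $y$. For $\rho>0$ and $x\in\mathbb{B}^n$ let $E(x,\rho)=\{y\in\mathbb{B}^n:\beta(x,y)<\rho\}$, $|E(x,\rho)|=v(E(x,\rho))$, $$\hat f(x,\rho)=\frac1{|E(x,\rho)|}\int_{E(x,\rho)}f\,dv,\qquad A_2(f,\rho,x)=\frac1{|E(x,\rho)|}\int_{E(x,\rho)}|f(y)-\hat f(x,\rho)|^2\,dv(y),$$ and let $\mathrm{VMO}(\mathbb{B}^n)$ be the set of all $f\in L^\infty(\mathbb{B}^n)$ such that $A_2(f,\rho,x)\to0$ as $\rho\to0$, uniformly for $x\in\mathbb{B}^n$. Theorem. If $f\in\mathrm{VMO}(\mathbb{B}^n)$, then $\lim_{\lambda\to\infty}\|f\|_{\mathrm{BMO}^\lambda}=0$.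 -/

import Mathlib

open MeasureTheory Filter Topology

noncomputable section

namespace UnitBall

/-- Complex Euclidean space `ℂⁿ` with the norm `|z| = (∑ |z_j|²)^(1/2)`. -/
abbrev Cn (n : ℕ) : Type := EuclideanSpace ℂ (Fin n)

/-- The open Euclidean unit ball `𝔹ⁿ` of `ℂⁿ`. -/
def unitBall (n : ℕ) : Set (Cn n) := Metric.ball 0 1

/-- Jordan triple determinant of the unit ball, `h(z, w) = 1 - ∑ z_j conj(w_j)`.
(Mathlib's inner product is conjugate-linear in its first argument.) -/
def h {n : ℕ} (z w : Cn n) : ℂ := 1 - inner ℂ w z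

/-- The genus `p = n + 1` of the unit ball. -/
def genus (n : ℕ) : ℝ := (n : ℝ) + 1

/-- Lebesgue measure `v` on the unit ball, normalized to total mass one. -/
def v (n : ℕ) : Measure (Cn n) :=
  (volume (unitBall n))⁻¹ • volume.restrict (unitBall n)

/-- The normalizing constant `c_lam`, chosen such that `v_lam` has total mass one. -/
def c (n : ℕ) (lam : ℝ) : ℝ :=
  (∫ z, (1 - ‖z‖ ^ 2) ^ (lam - genus n) ∂(v n))⁻¹

/-- The weighted measure `dv_lam(z) = c_lam h(z, z)^(lam - p) dv(z)`, where `h(z, z) = 1 - |z|²`. -/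
def vWeighted (n : ℕ) (lam : ℝ) : Measure (Cn n) :=
  (v n).withDensity fun z => ENNReal.ofReal (c n lam * (1 - ‖z‖ ^ 2) ^ (lam - genus n))

/-- The reproducing kernel `K_lam(z, w) = h(z, w)^(-lam)` of the weighted Bergman space of
holomorphic functions in `L²(v_lam)`. The power is the principal one: `Re h(z, w) > 0` for `z, w`
in the ball. -/
def K {n : ℕ} (lam : ℝ) (z w : Cn n) : ℂ := h z w ^ (-(lam : ℂ))

/-- The normalized reproducing kernel `k_w(z) = K(z, w) / ‖K(·, w)‖`, with the norm of
`L²(v_lam)`. -/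
def k {n : ℕ} (lam : ℝ) (w z : Cn n) : ℂ :=
  K lam z w / (Real.sqrt (∫ u, ‖K lam u w‖ ^ 2 ∂(vWeighted n lam)) : ℂ)

/-- The Berezin transform `B_lam(f)(z) = ∫ f(w) |k_z(w)|² dv_lam(w)`. -/
def berezin {n : ℕ} (lam : ℝ) (f : Cn n → ℂ) (z : Cn n) : ℂ :=
  ∫ w, f w * ((‖k lam z w‖ ^ 2 : ℝ) : ℂ) ∂(vWeighted n lam)

/-- The mean oscillation `MO_lam(f)(z) = B_lam(|f|²)(z) - |B_lam(f)(z)|²` (a real number). -/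
def MO {n : ℕ} (lam : ℝ) (f : Cn n → ℂ) (z : Cn n) : ℝ :=
  (berezin lam (fun w => ((‖f w‖ ^ 2 : ℝ) : ℂ)) z).re - ‖berezin lam f z‖ ^ 2

/-- The seminorm `‖f‖_{BMO^lam} = sup {√(MO_lam(f)(z)) : z ∈ 𝔹ⁿ}`, with values in `[0, ∞]`. -/
def bmoSeminorm {n : ℕ} (lam : ℝ) (f : Cn n → ℂ) : ENNReal :=
  ⨆ z ∈ unitBall n, ENNReal.ofReal (Real.sqrt (MO lam f z))

/-- The Wirtinger derivative `∂u/∂z_i = (∂u/∂x_i - i ∂u/∂y_i) / 2`. -/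
def wirtinger {n : ℕ} (i : Fin n) (u : Cn n → ℂ) (z : Cn n) : ℂ :=
  (fderiv ℝ u z (EuclideanSpace.single i 1)
    - Complex.I * fderiv ℝ u z (EuclideanSpace.single i Complex.I)) / 2

/-- The conjugate Wirtinger derivative `∂u/∂conj(z_j) = (∂u/∂x_j + i ∂u/∂y_j) / 2`. -/
def wirtingerBar {n : ℕ} (j : Fin n) (u : Cn n → ℂ) (z : Cn n) : ℂ :=
  (fderiv ℝ u z (EuclideanSpace.single j 1)
    + Complex.I * fderiv ℝ u z (EuclideanSpace.single j Complex.I)) / 2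

/-- The Bergman metric tensor `g_ij(z) = ∂²/∂z_i∂conj(z_j) log K_p(z, z)`. -/
def bergmanTensor {n : ℕ} (z : Cn n) (i j : Fin n) : ℂ :=
  wirtinger i (wirtingerBar j fun u => Complex.log (K (genus n) u u)) z

/-- The length `(∑ g_ij(z) ξ_i conj(ξ_j))^(1/2)` of a tangent vector `ξ` at `z`. -/
def bergmanNorm {n : ℕ} (z ξ : Cn n) : ℝ :=
  Real.sqrt (∑ i, ∑ j, bergmanTensor z i j * ξ i * (starRingEnd ℂ) (ξ j)).re

/-- The Bergman length of a curve parametrized by `[0, 1]`. -/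
def bergmanLength {n : ℕ} (γ : ℝ → Cn n) : ℝ :=
  ∫ t in (0 : ℝ)..1, bergmanNorm (γ t) (derivWithin γ (Set.Icc 0 1) t)

/-- The Bergman distance `β(x, y)`: the infimum of the Bergman lengths of the `C¹` curves in the
ball from `x` to `y`. -/
def bergmanDist {n : ℕ} (x y : Cn n) : ℝ :=
  sInf {L : ℝ | ∃ γ : ℝ → Cn n, ContDiffOn ℝ 1 γ (Set.Icc 0 1) ∧
    (∀ t ∈ Set.Icc (0 : ℝ) 1, γ t ∈ unitBall n) ∧ γ 0 = x ∧ γ 1 = y ∧ L = bergmanLength γ}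

/-- The Bergman ball `E(x, ρ)`. -/
def bergmanBall {n : ℕ} (x : Cn n) (ρ : ℝ) : Set (Cn n) :=
  {y | y ∈ unitBall n ∧ bergmanDist x y < ρ}

/-- The average of `f` over the Bergman ball `E(x, ρ)`. -/
def ballAverage {n : ℕ} (f : Cn n → ℂ) (ρ : ℝ) (x : Cn n) : ℂ :=
  ⨍ y in bergmanBall x ρ, f y ∂(v n)

/-- `A₂(f, ρ, x)`: the average over `E(x, ρ)` of `|f - ballAverage f ρ x|²`. -/
def A2 {n : ℕ} (f : Cn n → ℂ) (ρ : ℝ) (x : Cn n) : ℝ :=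
  ⨍ y in bergmanBall x ρ, ‖f y - ballAverage f ρ x‖ ^ 2 ∂(v n)

/-- `VMO(𝔹ⁿ)`: the (essentially) bounded measurable functions on the ball such that
`A₂(f, ρ, x) → 0` as `ρ → 0`, uniformly in `x ∈ 𝔹ⁿ`. -/
def VMO (n : ℕ) : Set (Cn n → ℂ) :=
  {f | MemLp f ⊤ (v n) ∧
    TendstoUniformlyOn (fun (ρ : ℝ) (x : Cn n) => A2 f ρ x) (fun _ => 0) (𝓝[>] 0) (unitBall n)}

end UnitBall

end

noncomputable section

namespace UnitBall

/-! ### Algebra of the kernel `h` -/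

/-! The measure `|k_z|² dv_lam` is a probability measure concentrated, uniformly in `z`, at Bergman
distance of order `1 / √lam` from `z`, and `MO` is the variance of `f` under it. A variance is at
most the mean square distance to any constant; the constant taken is the average of `f` over `E(z,
ρ)` with `ρ = R / √lam`. Near `z` the density is at most `9 ^ (n + 1) * exp (lam * ρ ^ 2)` divided
by the measure of `E(z, ρ)` (`exists_density_bound`), so this part is controlled by `A2 f ρ z`, with
a constant depending only on `n` and `R`. Far from `z`, `f` is bounded and Markov's inequality
applies, because `1 - kernelRatio z` has mean exactly `n / lam`
(`integral_one_sub_kernelRatio_mul_density`); this part is `O(1 / R ^ 2)`. Both are combined in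
`MO_le_A2_add`; one fixes `R` large and then lets `lam` tend to infinity. Automorphisms of the ball
are never used. The invariant `kernelRatio` replaces them: the density is its power `lam` against
the invariant measure (`weight_eq`), it is compared with the Bergman distance from both sides
(`neg_log_kernelRatio_le`, `bergmanDist_le_sqrt`), and its mean comes from the divergence theorem
(`integral_weight_identity`). -/

lemma mem_unitBall_iff {n : ℕ} {z : Cn n} : z ∈ unitBall n ↔ 0 < 1 - ‖z‖ ^ 2 := by
  rw [unitBall, mem_ball_zero_iff, sub_pos, sq_lt_one_iff_abs_lt_one, abs_norm]

lemma one_sub_normSq_pos {n : ℕ} {z : Cn n} (hz : z ∈ unitBall n) : 0 < 1 - ‖z‖ ^ 2 :=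
  mem_unitBall_iff.1 hz

lemma inner_self_ofReal {n : ℕ} (z : Cn n) : inner ℂ z z = ((‖z‖ ^ 2 : ℝ) : ℂ) := by
  rw [inner_self_eq_norm_sq_to_K]; simp

lemma h_self {n : ℕ} (z : Cn n) : h z z = ((1 - ‖z‖ ^ 2 : ℝ) : ℂ) := by
  rw [h, inner_self_ofReal]; push_cast; rfl

lemma conj_h {n : ℕ} (z w : Cn n) : (starRingEnd ℂ) (h z w) = h w z := by
  simp [h]

lemma norm_h_comm {n : ℕ} (z w : Cn n) : ‖h z w‖ = ‖h w z‖ := by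
  rw [← conj_h, RCLike.norm_conj]

/-- The hypothesis on the product also covers `w` on the boundary sphere, where the flux and the
weight must still be regular. -/
lemma h_ne_zero_of_norm_mul_lt {n : ℕ} {z w : Cn n} (hzw : ‖z‖ * ‖w‖ < 1) : h w z ≠ 0 := by
  intro h0
  have h1 : inner ℂ z w = 1 := by rw [h, sub_eq_zero] at h0; exact h0.symm
  have h2 := norm_inner_le_norm (𝕜 := ℂ) z w
  rw [h1, norm_one] at h2
  linarith

lemma h_ne_zero {n : ℕ} {z w : Cn n} (hz : z ∈ unitBall n) (hw : w ∈ unitBall n) : h w z ≠ 0 := by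
  apply h_ne_zero_of_norm_mul_lt
  rw [unitBall, mem_ball_zero_iff] at hz hw
  nlinarith [norm_nonneg z, norm_nonneg w]

lemma normSq_h_pos {n : ℕ} {z w : Cn n} (hz : z ∈ unitBall n) (hw : w ∈ unitBall n) :
    0 < ‖h w z‖ ^ 2 := by
  have := norm_pos_iff.2 (h_ne_zero hz hw); positivity

lemma inner_sub_right_eq {n : ℕ} (z w : Cn n) :
    inner ℂ z (w - z) = ((1 - ‖z‖ ^ 2 : ℝ) : ℂ) - h w z := by
  rw [inner_sub_right, inner_self_ofReal, h]; push_cast; ring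

/-- The Bergman quadratic form, up to the factor `n + 1`. -/
def bergmanForm {n : ℕ} (z ξ : Cn n) : ℝ :=
  ‖ξ‖ ^ 2 / (1 - ‖z‖ ^ 2) + ‖inner ℂ z ξ‖ ^ 2 / (1 - ‖z‖ ^ 2) ^ 2

lemma bergmanForm_nonneg {n : ℕ} {z : Cn n} (hz : z ∈ unitBall n) (ξ : Cn n) :
    0 ≤ bergmanForm z ξ := by
  have := one_sub_normSq_pos hz
  unfold bergmanForm; positivity

/-- The invariant quantity `h(z,z) h(w,w) / |h(z,w)|²`, which is `1 - |φ_z(w)|²` for the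
involutive automorphism `φ_z` of the ball exchanging `0` and `z`. -/
def kernelRatio {n : ℕ} (z w : Cn n) : ℝ :=
  (1 - ‖z‖ ^ 2) * (1 - ‖w‖ ^ 2) / ‖h w z‖ ^ 2

lemma kernelRatio_comm {n : ℕ} (z w : Cn n) : kernelRatio z w = kernelRatio w z := by
  rw [kernelRatio, kernelRatio, norm_h_comm, mul_comm (1 - ‖z‖ ^ 2)]

lemma kernelRatio_pos {n : ℕ} {z w : Cn n} (hz : z ∈ unitBall n) (hw : w ∈ unitBall n) :
    0 < kernelRatio z w := by
  have := one_sub_normSq_pos hz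
  have := one_sub_normSq_pos hw
  have := normSq_h_pos hz hw
  unfold kernelRatio; positivity

/-- Expand the square of `h w z = (1 - ‖z‖²) - ⟪z, w - z⟫`. The right side is a sum of nonnegative
terms, which gives `kernelRatio ≤ 1` and measures its defect from `1`. -/
lemma normSq_h_sub {n : ℕ} (z w : Cn n) :
    ‖h w z‖ ^ 2 - (1 - ‖z‖ ^ 2) * (1 - ‖w‖ ^ 2) =
      (1 - ‖z‖ ^ 2) * ‖w - z‖ ^ 2 + ‖inner ℂ z (w - z)‖ ^ 2 := by
  have h1 : ‖w - z‖ ^ 2 = ‖w‖ ^ 2 - 2 * (inner ℂ z w).re + ‖z‖ ^ 2 := by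
    rw [@norm_sub_sq ℂ, inner_re_symm (𝕜 := ℂ)]; rfl
  rw [h1, inner_sub_right, inner_self_ofReal, h, ← Complex.normSq_eq_norm_sq,
    ← Complex.normSq_eq_norm_sq, Complex.normSq_apply, Complex.normSq_apply]
  simp only [Complex.sub_re, Complex.sub_im, Complex.one_re, Complex.one_im, Complex.ofReal_re,
    Complex.ofReal_im]
  ring

lemma one_sub_kernelRatio {n : ℕ} {z w : Cn n} (hz : z ∈ unitBall n) (hw : w ∈ unitBall n) :
    1 - kernelRatio z w =
      ((1 - ‖z‖ ^ 2) * ‖w - z‖ ^ 2 + ‖inner ℂ z (w - z)‖ ^ 2) / ‖h w z‖ ^ 2 := by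
  have := (normSq_h_pos hz hw).ne'
  rw [← normSq_h_sub, kernelRatio, sub_div, div_self this]

lemma kernelRatio_le_one {n : ℕ} {z w : Cn n} (hz : z ∈ unitBall n) (hw : w ∈ unitBall n) :
    kernelRatio z w ≤ 1 := by
  have := one_sub_kernelRatio hz hw
  have h1 := one_sub_normSq_pos hz
  have : 0 ≤ 1 - kernelRatio z w := by rw [this]; positivity
  linarith

lemma norm_sub_h_le {n : ℕ} {z w : Cn n} (hz : z ∈ unitBall n) (hw : w ∈ unitBall n)
    {δ : ℝ} (hδ : 0 ≤ δ) (hD : 1 - kernelRatio z w ≤ δ ^ 2) :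
    ‖((1 - ‖z‖ ^ 2 : ℝ) : ℂ) - h w z‖ ≤ δ * ‖h w z‖ := by
  have hm := one_sub_normSq_pos hz
  rw [one_sub_kernelRatio hz hw, div_le_iff₀ (normSq_h_pos hz hw)] at hD
  rw [← inner_sub_right_eq]
  apply le_of_sq_le_sq _ (by positivity)
  nlinarith [mul_nonneg hm.le (sq_nonneg ‖w - z‖)]

lemma abs_sub_norm_h_le {n : ℕ} {z w : Cn n} (hz : z ∈ unitBall n) (hw : w ∈ unitBall n)
    {δ : ℝ} (hδ : 0 ≤ δ) (hD : 1 - kernelRatio z w ≤ δ ^ 2) :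
    |(1 - ‖z‖ ^ 2) - ‖h w z‖| ≤ δ * ‖h w z‖ := by
  have hm := one_sub_normSq_pos hz
  refine le_trans ?_ (norm_sub_h_le hz hw hδ hD)
  have := abs_norm_sub_norm_le ((1 - ‖z‖ ^ 2 : ℝ) : ℂ) (h w z)
  rwa [Complex.norm_of_nonneg hm.le] at this

/-- Both `1 - ‖z‖²` and `1 - ‖w‖²` lie between `1/2` and `3/2` times `‖h w z‖`, hence the factor
`3`. -/
lemma one_sub_normSq_le_three_mul {n : ℕ} {z w : Cn n} (hz : z ∈ unitBall n)
    (hw : w ∈ unitBall n) (hD : 1 - kernelRatio z w ≤ 1 / 4) :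
    1 - ‖z‖ ^ 2 ≤ 3 * (1 - ‖w‖ ^ 2) := by
  have h1 := abs_sub_norm_h_le hz hw (δ := 1 / 2) (by norm_num) (by linarith)
  have h2 := abs_sub_norm_h_le hw hz (δ := 1 / 2) (by norm_num)
    (by rw [kernelRatio_comm]; linarith)
  rw [abs_le] at h1 h2
  rw [norm_h_comm] at h2
  linarith

/-- Cauchy–Schwarz for the Bergman form, applied to the differential of `log kernelRatio z`. -/
lemma normSq_inner_div_sub_le {n : ℕ} {z w : Cn n} (hz : z ∈ unitBall n) (hw : w ∈ unitBall n)
    (ξ : Cn n) :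
    ‖inner ℂ w ξ / ((1 - ‖w‖ ^ 2 : ℝ) : ℂ) - inner ℂ z ξ / h w z‖ ^ 2 ≤
      (1 - kernelRatio z w) * bergmanForm w ξ := by
  set s : ℝ := 1 - ‖w‖ ^ 2 with hs
  have hs0 : 0 < s := one_sub_normSq_pos hw
  have hs' : (s : ℂ) ≠ 0 := by exact_mod_cast hs0.ne'
  have hq := h_ne_zero hz hw
  have e1 : inner ℂ w ξ / (s : ℂ) - inner ℂ z ξ / h w z =
      (inner ℂ (w - z) ξ + inner ℂ (w - z) w * (inner ℂ w ξ / s)) / h w z := by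
    have e2 : inner ℂ (w - z) w = h w z - s := by
      rw [inner_sub_left, inner_self_ofReal, h, hs]; push_cast; ring
    rw [e2, inner_sub_left]
    field_simp
    ring
  have hD : 1 - kernelRatio z w =
      (s * ‖w - z‖ ^ 2 + ‖inner ℂ (w - z) w‖ ^ 2) / ‖h w z‖ ^ 2 := by
    rw [kernelRatio_comm, one_sub_kernelRatio hw hz, norm_h_comm, norm_sub_rev z w,
      ← norm_inner_symm, ← neg_sub w z, inner_neg_left, norm_neg]
  rw [e1, norm_div, div_pow, hD, div_mul_eq_mul_div]
  apply div_le_div_of_nonneg_right _ (by positivity)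
  set A := ‖w - z‖
  set B := ‖inner ℂ (w - z) w‖
  set C := ‖ξ‖
  set E := ‖inner ℂ w ξ‖
  have hle : ‖inner ℂ (w - z) ξ + inner ℂ (w - z) w * (inner ℂ w ξ / s)‖ ≤ A * C + B * (E / s) := by
    refine (norm_add_le _ _).trans (add_le_add (norm_inner_le_norm _ _) ?_)
    rw [norm_mul, norm_div, Complex.norm_of_nonneg hs0.le]
  have hQ : bergmanForm w ξ = C ^ 2 / s + (E / s) ^ 2 := by
    rw [bergmanForm, ← hs, div_pow]
  have hpos : 0 ≤ A * C + B * (E / s) := by positivity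
  refine (pow_le_pow_left₀ (norm_nonneg _) hle 2).trans ?_
  rw [hQ]
  set F := E / s
  -- Lagrange's identity: the defect in the two-term Cauchy–Schwarz inequality is a square.
  have e3 : (s * A ^ 2 + B ^ 2) * (C ^ 2 / s + F ^ 2) - (A * C + B * F) ^ 2 =
      (s * A * F - B * C) ^ 2 / s := by
    field_simp; ring
  have : 0 ≤ (s * A * F - B * C) ^ 2 / s := by positivity
  linarith

/-! ### The Bergman tensor -/

lemma isOpen_unitBall (n : ℕ) : IsOpen (unitBall n) := Metric.isOpen_ball

lemma hasFDerivAt_one_sub_normSq {n : ℕ} (w : Cn n) :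
    ∃ L : Cn n →L[ℝ] ℝ, HasFDerivAt (fun w : Cn n => 1 - ‖w‖ ^ 2) L w ∧
      ∀ ξ, L ξ = -2 * (inner ℂ w ξ).re := by
  have h1 := ((hasFDerivAt_id (𝕜 := ℝ) w).inner ℂ (hasFDerivAt_id w))
  have h2 := (Complex.reCLM.hasFDerivAt.comp w h1).const_sub 1
  refine ⟨_, h2.congr_of_eventuallyEq (Eventually.of_forall fun u => ?_), fun ξ => ?_⟩
  · simp [← Complex.ofReal_pow]
  · have := inner_re_symm (𝕜 := ℂ) ξ w
    simp only [RCLike.re_eq_complex_re] at this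
    simp [fderivInnerCLM_apply, this]
    ring

lemma re_inner_single_one {n : ℕ} (z : Cn n) (j : Fin n) :
    (inner ℂ z (EuclideanSpace.single j (1 : ℂ))).re = (z j).re := by
  simp [EuclideanSpace.inner_single_right]

lemma re_inner_single_I {n : ℕ} (z : Cn n) (j : Fin n) :
    (inner ℂ z (EuclideanSpace.single j Complex.I)).re = (z j).im := by
  simp [EuclideanSpace.inner_single_right]

/-- On the diagonal `h` is real and positive, so the complex logarithm is the real function `-(n +
1) log (1 - ‖u‖²)`. -/
lemma wirtingerBar_logK {n : ℕ} (j : Fin n) {z : Cn n} (hz : z ∈ unitBall n) :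
    wirtingerBar j (fun u => Complex.log (K (genus n) u u)) z =
      genus n * (z j * (((1 - ‖z‖ ^ 2)⁻¹ : ℝ) : ℂ)) := by
  obtain ⟨L, hL, hLv⟩ := hasFDerivAt_one_sub_normSq z
  have hm := one_sub_normSq_pos hz
  have heq : (fun u : Cn n => Complex.log (K (genus n) u u)) =ᶠ[𝓝 z]
      fun u => ((-genus n * Real.log (1 - ‖u‖ ^ 2) : ℝ) : ℂ) := by
    filter_upwards [(isOpen_unitBall n).mem_nhds hz] with u hu
    have hu' := one_sub_normSq_pos hu
    rw [K, h_self, ← Complex.ofReal_neg, ← Complex.ofReal_cpow hu'.le, ← Complex.ofReal_log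
      (Real.rpow_nonneg hu'.le _), Real.log_rpow hu']
  have hd := Complex.ofRealCLM.hasFDerivAt.comp z ((hL.log hm.ne').const_mul (-genus n))
  have hd' := (hd.congr_of_eventuallyEq heq).fderiv
  rw [wirtingerBar, hd']
  simp only [ContinuousLinearMap.comp_apply, smul_apply, hLv,
    Complex.ofRealCLM_apply, smul_eq_mul, re_inner_single_one, re_inner_single_I]
  generalize (1 - ‖z‖ ^ 2)⁻¹ = s
  conv_rhs => rw [← Complex.re_add_im (z j)]
  push_cast
  ring

lemma bergmanTensor_eq {n : ℕ} {z : Cn n} (hz : z ∈ unitBall n) (i j : Fin n) :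
    bergmanTensor z i j = genus n * ((if i = j then 1 else 0) * (((1 - ‖z‖ ^ 2)⁻¹ : ℝ) : ℂ) +
      (starRingEnd ℂ) (z i) * z j * (((1 - ‖z‖ ^ 2)⁻¹ : ℝ) : ℂ) ^ 2) := by
  obtain ⟨L, hL, hLv⟩ := hasFDerivAt_one_sub_normSq z
  have hm := one_sub_normSq_pos hz
  have heq : wirtingerBar j (fun u : Cn n => Complex.log (K (genus n) u u)) =ᶠ[𝓝 z]
      fun u => genus n * (u j * (((1 - ‖u‖ ^ 2)⁻¹ : ℝ) : ℂ)) := by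
    filter_upwards [(isOpen_unitBall n).mem_nhds hz] with u hu
    rw [wirtingerBar_logK j hu]
  have hp : HasFDerivAt (fun u : Cn n => u j)
      ((EuclideanSpace.proj (𝕜 := ℂ) j).restrictScalars ℝ) z :=
    ((EuclideanSpace.proj (𝕜 := ℂ) j).restrictScalars ℝ).hasFDerivAt
  have hinv := Complex.ofRealCLM.hasFDerivAt.comp z ((hasDerivAt_inv hm.ne').comp_hasFDerivAt z hL)
  have hd := ((hp.mul hinv).const_mul (genus n : ℂ))
  have hd' := (hd.congr_of_eventuallyEq heq).fderiv
  rw [bergmanTensor, wirtinger, hd']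
  simp only [ContinuousLinearMap.comp_apply, smul_apply, add_apply, hLv,
    Complex.ofRealCLM_apply, smul_eq_mul, re_inner_single_one, re_inner_single_I,
    Function.comp_apply, ContinuousLinearMap.coe_restrictScalars', PiLp.proj_apply,
    PiLp.single_apply, ← inv_pow]
  generalize (1 - ‖z‖ ^ 2)⁻¹ = s
  have hc : (starRingEnd ℂ) (z i) = (z i).re - (z i).im * Complex.I :=
    Complex.ext (by simp) (by simp)
  rw [hc]
  by_cases hij : j = i
  · subst hij
    simp only [if_true]
    push_cast
    linear_combination (-(1 : ℂ) / 2 * genus n * s) * Complex.I_mul_I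
  · rw [if_neg hij, if_neg hij, if_neg (Ne.symm hij)]
    push_cast
    ring

lemma bergmanNorm_eq {n : ℕ} {z : Cn n} (hz : z ∈ unitBall n) (ξ : Cn n) :
    bergmanNorm z ξ = Real.sqrt (((n : ℝ) + 1) * bergmanForm z ξ) := by
  have e1 : (∑ i, ∑ j, bergmanTensor z i j * ξ i * (starRingEnd ℂ) (ξ j)) =
      ((((n : ℝ) + 1) * bergmanForm z ξ : ℝ) : ℂ) := by
    have e2 : inner ℂ z ξ = ∑ i, (starRingEnd ℂ) (z i) * ξ i := by
      rw [PiLp.inner_apply]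
      exact Finset.sum_congr rfl fun i _ => by simp [mul_comm]
    have e3 : ((‖inner ℂ z ξ‖ ^ 2 : ℝ) : ℂ) =
        ∑ i, ∑ j, ((starRingEnd ℂ) (z i) * ξ i) * (z j * (starRingEnd ℂ) (ξ j)) := by
      rw [Complex.ofReal_pow, ← Complex.mul_conj', e2, map_sum, Finset.sum_mul_sum]
      simp
    have e4 : ((‖ξ‖ ^ 2 : ℝ) : ℂ) =
        ∑ i, ∑ j, (if i = j then (1 : ℂ) else 0) * (ξ i * (starRingEnd ℂ) (ξ j)) := by
      rw [EuclideanSpace.norm_sq_eq]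
      simp [Complex.mul_conj']
    rw [bergmanForm, div_eq_mul_inv, div_eq_mul_inv, Complex.ofReal_mul, Complex.ofReal_add, Complex.ofReal_add,
      Complex.ofReal_mul, Complex.ofReal_mul, e3, e4, ← inv_pow, Finset.sum_mul, Finset.sum_mul,
      ← Finset.sum_add_distrib, Finset.mul_sum]
    refine Finset.sum_congr rfl fun i _ => ?_
    rw [Finset.sum_mul, Finset.sum_mul, ← Finset.sum_add_distrib, Finset.mul_sum]
    refine Finset.sum_congr rfl fun j _ => ?_
    rw [bergmanTensor_eq hz, genus]
    push_cast
    ring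
  rw [bergmanNorm, e1, Complex.ofReal_re]

/-! ### Comparison of the Bergman distance with `kernelRatio` -/

lemma bergmanLength_nonneg {n : ℕ} (γ : ℝ → Cn n) : 0 ≤ bergmanLength γ :=
  intervalIntegral.integral_nonneg zero_le_one fun _ _ => Real.sqrt_nonneg _

lemma bergmanDist_le_bergmanLength {n : ℕ} {γ : ℝ → Cn n} (hγ : ContDiffOn ℝ 1 γ (Set.Icc 0 1))
    (hb : ∀ t ∈ Set.Icc (0 : ℝ) 1, γ t ∈ unitBall n) :
    bergmanDist (γ 0) (γ 1) ≤ bergmanLength γ := by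
  refine csInf_le ⟨0, ?_⟩ ⟨γ, hγ, hb, rfl, rfl, rfl⟩
  rintro _ ⟨δ, -, -, -, -, rfl⟩
  exact bergmanLength_nonneg δ

lemma segment_mem_unitBall {n : ℕ} {x y : Cn n} (hx : x ∈ unitBall n) (hy : y ∈ unitBall n)
    {t : ℝ} (ht : t ∈ Set.Icc (0 : ℝ) 1) : x + t • (y - x) ∈ unitBall n :=
  (convex_ball (0 : Cn n) 1).add_smul_sub_mem hx hy ht

lemma contDiff_segment {n : ℕ} (x y : Cn n) :
    ContDiff ℝ 1 (fun t : ℝ => x + t • (y - x)) :=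
  contDiff_const.add (contDiff_id.smul contDiff_const)

lemma exists_bergmanLength_lt {n : ℕ} {x y : Cn n} (hx : x ∈ unitBall n) (hy : y ∈ unitBall n)
    {ρ : ℝ} (hρ : bergmanDist x y < ρ) :
    ∃ γ : ℝ → Cn n, ContDiffOn ℝ 1 γ (Set.Icc 0 1) ∧
      (∀ t ∈ Set.Icc (0 : ℝ) 1, γ t ∈ unitBall n) ∧ γ 0 = x ∧ γ 1 = y ∧ bergmanLength γ < ρ := by
  rw [bergmanDist] at hρ
  -- The straight segment shows that the set of lengths is nonempty, without which `sInf` would take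
  -- the default value `0`.
  obtain ⟨L, ⟨γ, h1, h2, h3, h4, rfl⟩, hL⟩ := exists_lt_of_csInf_lt
    (by exact ⟨_, fun t : ℝ => x + t • (y - x), (contDiff_segment x y).contDiffOn,
        fun t ht => segment_mem_unitBall hx hy ht, by simp, by simp, rfl⟩) hρ
  exact ⟨γ, h1, h2, h3, h4, hL⟩

lemma continuousOn_bergmanNorm_curve {n : ℕ} {γ : ℝ → Cn n}
    (hγ : ContDiffOn ℝ 1 γ (Set.Icc 0 1)) (hb : ∀ t ∈ Set.Icc (0 : ℝ) 1, γ t ∈ unitBall n) :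
    ContinuousOn (fun t => bergmanNorm (γ t) (derivWithin γ (Set.Icc 0 1) t)) (Set.Icc 0 1) := by
  have hd := hγ.continuousOn_derivWithin (uniqueDiffOn_Icc zero_lt_one) le_rfl
  have hc := hγ.continuousOn
  have hne : ∀ t ∈ Set.Icc (0 : ℝ) 1, 1 - ‖γ t‖ ^ 2 ≠ 0 :=
    fun t ht => (one_sub_normSq_pos (hb t ht)).ne'
  have hi : ContinuousOn (fun t => inner ℂ (γ t) (derivWithin γ (Set.Icc 0 1) t))
      (Set.Icc 0 1) := hc.inner hd
  refine ContinuousOn.congr (f := fun t => Real.sqrt (((n : ℝ) + 1) *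
    bergmanForm (γ t) (derivWithin γ (Set.Icc 0 1) t))) ?_ fun t ht => bergmanNorm_eq (hb t ht) _
  unfold bergmanForm
  refine (continuousOn_const.mul (ContinuousOn.add ?_ ?_)).sqrt
  · exact (hd.norm.pow 2).div (continuousOn_const.sub (hc.norm.pow 2)) hne
  · exact (hi.norm.pow 2).div ((continuousOn_const.sub (hc.norm.pow 2)).pow 2)
      fun t ht => pow_ne_zero 2 (hne t ht)

lemma hasDerivAt_one_sub_normSq_curve {n : ℕ} {γ : ℝ → Cn n} {γ' : Cn n} {t : ℝ}
    (hγ : HasDerivAt γ γ' t) :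
    HasDerivAt (fun t => 1 - ‖γ t‖ ^ 2) (-2 * (inner ℂ (γ t) γ').re) t := by
  obtain ⟨L, hL, hLv⟩ := hasFDerivAt_one_sub_normSq (γ t)
  exact (hL.comp_hasDerivAt t hγ).congr_deriv (hLv _)

lemma hasDerivAt_normSq_h_curve {n : ℕ} (z : Cn n) {γ : ℝ → Cn n} {γ' : Cn n} {t : ℝ}
    (hγ : HasDerivAt γ γ' t) :
    HasDerivAt (fun t => ‖h (γ t) z‖ ^ 2)
      (-2 * ((starRingEnd ℂ) (h (γ t) z) * inner ℂ z γ').re) t := by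
  have h1 : HasDerivAt (fun t => h (γ t) z) (-inner ℂ z γ') t := by
    have := ((hasDerivAt_const t z).inner ℂ hγ).const_sub 1
    simpa [h] using this
  have h2 := h1.norm_sq
  refine h2.congr_deriv ?_
  rw [Complex.inner]
  simp
  ring

/-- Minus the logarithm of `kernelRatio z` grows along a curve at most as fast as twice the
product of its square root with the speed of the curve. -/
lemma hasDerivAt_neg_log_kernelRatio {n : ℕ} {z : Cn n} (hz : z ∈ unitBall n) {γ : ℝ → Cn n}
    {γ' : Cn n} {t : ℝ} (hγ : HasDerivAt γ γ' t) (ht : γ t ∈ unitBall n) :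
    ∃ g' : ℝ, HasDerivAt (fun t => -Real.log (kernelRatio z (γ t))) g' t ∧
      g' ≤ 2 * Real.sqrt (-Real.log (kernelRatio z (γ t))) * Real.sqrt (bergmanForm (γ t) γ') := by
  have hm := one_sub_normSq_pos hz
  have hu := one_sub_normSq_pos ht
  have hq := normSq_h_pos hz ht
  have hq' := h_ne_zero hz ht
  have hT := kernelRatio_pos hz ht
  have hd := (((hasDerivAt_one_sub_normSq_curve hγ).const_mul (1 - ‖z‖ ^ 2)).div
    (hasDerivAt_normSq_h_curve z hγ) hq.ne').log (by exact hT.ne')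
  refine ⟨_, hd.neg, ?_⟩
  set a : ℂ := inner ℂ (γ t) γ' / ((1 - ‖γ t‖ ^ 2 : ℝ) : ℂ) - inner ℂ z γ' / h (γ t) z with ha
  have hCS := normSq_inner_div_sub_le hz ht γ'
  rw [← ha] at hCS
  -- This turns the Cauchy–Schwarz factor `1 - kernelRatio` into the function being differentiated,
  -- so the differential inequality closes up.
  have hlog : 1 - kernelRatio z (γ t) ≤ -Real.log (kernelRatio z (γ t)) := by
    linarith [Real.log_le_sub_one_of_pos hT]
  have hQ := bergmanForm_nonneg ht γ'
  have hD : 0 ≤ 1 - kernelRatio z (γ t) := by linarith [kernelRatio_le_one hz ht]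
  have hre : a.re = (inner ℂ (γ t) γ').re / (1 - ‖γ t‖ ^ 2) -
      ((starRingEnd ℂ) (h (γ t) z) * inner ℂ z γ').re / ‖h (γ t) z‖ ^ 2 := by
    rw [ha, Complex.sub_re, Complex.div_ofReal_re]
    congr 1
    rw [← Complex.ofReal_re (((starRingEnd ℂ) (h (γ t) z) * inner ℂ z γ').re / ‖h (γ t) z‖ ^ 2)]
    have : inner ℂ z γ' / h (γ t) z =
        ((starRingEnd ℂ) (h (γ t) z) * inner ℂ z γ') / ((‖h (γ t) z‖ ^ 2 : ℝ) : ℂ) := by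
      rw [Complex.ofReal_pow, ← Complex.mul_conj']
      have : (starRingEnd ℂ) (h (γ t) z) ≠ 0 := (map_ne_zero _).2 hq'
      field_simp
    rw [this, Complex.div_ofReal_re, Complex.ofReal_re]
  have hle : a.re ≤ Real.sqrt (-Real.log (kernelRatio z (γ t))) *
      Real.sqrt (bergmanForm (γ t) γ') := by
    rw [← Real.sqrt_mul (hD.trans hlog)]
    refine (Complex.re_le_norm a).trans (Real.le_sqrt_of_sq_le (hCS.trans ?_))
    exact mul_le_mul_of_nonneg_right hlog hQ
  refine le_trans (le_of_eq ?_) (by linarith [hle] : 2 * a.re ≤ _)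
  rw [hre]
  have hm' := hm.ne'
  simp only [Pi.div_apply]
  field_simp
  ring

/-- The Bergman distance dominates `√(-log kernelRatio)`. -/
lemma neg_log_kernelRatio_le {n : ℕ} {x y : Cn n} (hx : x ∈ unitBall n) (hy : y ∈ unitBall n)
    {ρ : ℝ} (hρ : bergmanDist x y < ρ) : -Real.log (kernelRatio x y) ≤ ρ ^ 2 := by
  obtain ⟨γ, hγ, hb, h0, h1, hL⟩ := exists_bergmanLength_lt hx hy hρ
  have hρ0 : 0 ≤ ρ := (bergmanLength_nonneg γ).trans hL.le
  set G : ℝ → ℝ := fun t => -Real.log (kernelRatio x (γ t)) with hG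
  have hG0 : ∀ t ∈ Set.Icc (0 : ℝ) 1, 0 ≤ G t := fun t ht => by
    have := Real.log_nonpos (kernelRatio_pos hx (hb t ht)).le (kernelRatio_le_one hx (hb t ht))
    simp only [hG]; linarith
  have hcγ := hγ.continuousOn
  have hGc : ContinuousOn G (Set.Icc 0 1) := by
    refine (ContinuousOn.log ?_ fun t ht => (kernelRatio_pos hx (hb t ht)).ne').neg
    unfold kernelRatio
    refine ContinuousOn.div ?_ ?_ fun t ht => (normSq_h_pos hx (hb t ht)).ne'
    · exact continuousOn_const.mul (continuousOn_const.sub (hcγ.norm.pow 2))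
    · exact ((continuousOn_const.sub (continuousOn_const.inner hcγ)).norm.pow 2)
  -- The square root is not differentiable at `0`, and `G` vanishes at the starting point; adding
  -- `ε` removes the singularity.
  have key : ∀ ε : ℝ, 0 < ε → Real.sqrt (G 1 + ε) ≤ Real.sqrt ε + ρ := by
    intro ε hε
    have hder : ∀ t ∈ Set.Ioo (0 : ℝ) 1, ∃ g' : ℝ,
        HasDerivAt (fun t => Real.sqrt (G t + ε)) g' t ∧
          g' ≤ bergmanNorm (γ t) (derivWithin γ (Set.Icc 0 1) t) := by
      intro t ht
      have htI := Set.Ioo_subset_Icc_self ht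
      have hn : Set.Icc (0 : ℝ) 1 ∈ 𝓝 t := Icc_mem_nhds ht.1 ht.2
      have hγd : HasDerivAt γ (derivWithin γ (Set.Icc 0 1) t) t :=
        ((hγ.differentiableOn one_ne_zero t htI).hasDerivWithinAt).hasDerivAt hn
      obtain ⟨g', hg, hle⟩ := hasDerivAt_neg_log_kernelRatio hx hγd (hb t htI)
      have hpos : 0 < G t + ε := by linarith [hG0 t htI]
      refine ⟨_, (hg.add_const ε).sqrt hpos.ne', ?_⟩
      rw [bergmanNorm_eq (hb t htI), div_le_iff₀ (by positivity)]
      have hQ := bergmanForm_nonneg (hb t htI) (derivWithin γ (Set.Icc 0 1) t)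
      set Q := bergmanForm (γ t) (derivWithin γ (Set.Icc 0 1) t)
      -- The factor `n + 1 ≥ 1` of the Bergman metric is simply dropped.
      have e1 : Real.sqrt Q ≤ Real.sqrt (((n : ℝ) + 1) * Q) :=
        Real.sqrt_le_sqrt (by nlinarith [(Nat.cast_nonneg n : (0 : ℝ) ≤ n)])
      have e2 : Real.sqrt (-Real.log (kernelRatio x (γ t))) ≤ Real.sqrt (G t + ε) :=
        Real.sqrt_le_sqrt (by simp only [hG]; linarith)
      calc g' ≤ _ := hle
        _ ≤ 2 * Real.sqrt (G t + ε) * Real.sqrt (((n : ℝ) + 1) * Q) := by gcongr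
        _ = _ := by ring
    choose! g' hg hle using hder
    have hint := (continuousOn_bergmanNorm_curve hγ hb).integrableOn_Icc (μ := volume)
    have := intervalIntegral.sub_le_integral_of_hasDeriv_right_of_le zero_le_one
      ((hGc.add continuousOn_const).sqrt) (fun t ht => (hg t ht).hasDerivWithinAt) hint hle
    have hG00 : G 0 = 0 := by
      have : kernelRatio x x = 1 := by
        have hm := one_sub_normSq_pos hx
        rw [kernelRatio, h_self, Complex.norm_of_nonneg hm.le, ← pow_two, div_self]
        positivity
      simp [hG, h0, this]
    simp only [Pi.add_apply, hG00, zero_add] at this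
    have h2 : ∫ t in (0 : ℝ)..1, bergmanNorm (γ t) (derivWithin γ (Set.Icc 0 1) t) < ρ := hL
    linarith
  have hG1 : 0 ≤ G 1 := hG0 1 (by simp)
  have hlim : Real.sqrt (G 1) ≤ ρ := by
    refine le_of_forall_pos_le_add fun ε hε => ?_
    have := key (ε ^ 2) (by positivity)
    rw [Real.sqrt_sq hε.le] at this
    have e : Real.sqrt (G 1) ≤ Real.sqrt (G 1 + ε ^ 2) := Real.sqrt_le_sqrt (by nlinarith)
    linarith
  have : G 1 ≤ ρ ^ 2 := (Real.sqrt_le_left hρ0).1 hlim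
  simpa [hG, h1] using this

/-- With `m = 1 - ‖x‖²` and `D = 1 - kernelRatio x y`, the displacement satisfies `‖y - x‖² ≤ 4Dm`
and `‖⟪x, y - x⟫‖² ≤ 4Dm²`. For small `D` this keeps `1 - ‖·‖²` above `m / 4` on the whole segment,
so both terms of the form are `O(D)`: they contribute `16D` and `100D`. -/
lemma bergmanForm_segment_le {n : ℕ} {x y : Cn n} (hx : x ∈ unitBall n) (hy : y ∈ unitBall n)
    (hD : 1 - kernelRatio x y ≤ 1 / 64) {t : ℝ} (ht : t ∈ Set.Icc (0 : ℝ) 1) :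
    bergmanForm (x + t • (y - x)) (y - x) ≤ 116 * (1 - kernelRatio x y) := by
  have hm := one_sub_normSq_pos hx
  have hq := normSq_h_pos hx hy
  have habs := abs_sub_norm_h_le hx hy (δ := 1 / 8) (by norm_num) (by linarith)
  have hDeq := one_sub_kernelRatio hx hy
  set ξ := y - x with hξ
  set m : ℝ := 1 - ‖x‖ ^ 2 with hmdef
  set D : ℝ := 1 - kernelRatio x y with hDdef
  set a : ℝ := ‖h y x‖ with hadef
  set A : ℝ := ‖ξ‖ with hA
  set B : ℝ := ‖inner ℂ x ξ‖ with hB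
  have ha0 : 0 ≤ a := norm_nonneg _
  have hA0 : 0 ≤ A := norm_nonneg _
  have hB0 : 0 ≤ B := norm_nonneg _
  rw [abs_le] at habs
  have ham : a ≤ 2 * m := by linarith
  have hnum : m * A ^ 2 + B ^ 2 = D * a ^ 2 := by rw [hDeq, div_mul_cancel₀ _ hq.ne']
  have hD0 : 0 ≤ D := by rw [hDeq]; positivity
  have hnum' : m * A ^ 2 + B ^ 2 ≤ 4 * D * m ^ 2 := by
    have : a ^ 2 ≤ (2 * m) ^ 2 := pow_le_pow_left₀ ha0 ham 2
    have := mul_le_mul_of_nonneg_left this hD0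
    rw [hnum]; linarith
  have hB1 : B ^ 2 ≤ 4 * D * m ^ 2 := by nlinarith
  have hA1 : A ^ 2 ≤ 4 * D * m := by
    have : m * A ^ 2 ≤ m * (4 * D * m) := by nlinarith
    exact le_of_mul_le_mul_left this hm
  have hBm : B ≤ m / 4 := by
    apply le_of_sq_le_sq _ (by positivity)
    nlinarith
  have hAm : A ^ 2 ≤ m / 16 := by nlinarith
  set w : Cn n := x + t • ξ with hw
  have htA : ‖t • ξ‖ ^ 2 ≤ A ^ 2 := by
    rw [norm_smul, mul_pow, Real.norm_eq_abs, sq_abs]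
    have : t ^ 2 ≤ 1 := by nlinarith [ht.1, ht.2]
    nlinarith [sq_nonneg A]
  have hu : m / 4 ≤ 1 - ‖w‖ ^ 2 := by
    have e : ‖w‖ ^ 2 = ‖x‖ ^ 2 + 2 * (t * (inner ℂ x ξ).re) + ‖t • ξ‖ ^ 2 := by
      rw [hw, @norm_add_sq ℂ, inner_smul_right_eq_smul]
      simp
    have e2 : t * (inner ℂ x ξ).re ≤ B := by
      have := Complex.re_le_norm (inner ℂ x ξ)
      nlinarith [ht.1, ht.2]
    rw [e]
    linarith
  have hin : ‖inner ℂ w ξ‖ ≤ B + A ^ 2 := by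
    have e : inner ℂ w ξ = inner ℂ x ξ + ((t * A ^ 2 : ℝ) : ℂ) := by
      rw [hw, inner_add_left, ← Complex.coe_smul t ξ, inner_smul_left, inner_self_ofReal]
      simp [hA]
    rw [e]
    refine (norm_add_le _ _).trans (add_le_add le_rfl ?_)
    rw [Complex.norm_of_nonneg (mul_nonneg ht.1 (sq_nonneg _))]
    nlinarith [ht.1, ht.2, sq_nonneg A]
  have hu0 : 0 < 1 - ‖w‖ ^ 2 := by linarith
  have hin2 : ‖inner ℂ w ξ‖ ^ 2 ≤ (25 / 16) * (4 * D * m ^ 2) := by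
    have e1 : ‖inner ℂ w ξ‖ ^ 2 ≤ (B + A ^ 2) ^ 2 := pow_le_pow_left₀ (norm_nonneg _) hin 2
    have e2 : (B + A ^ 2) ^ 2 ≤ (5 / 4) * B ^ 2 + 5 * (A ^ 2) ^ 2 := by
      -- Young's inequality, weighted so that the small term `A ^ 4` takes the large constant.
      linarith [sq_nonneg (B - 4 * A ^ 2)]
    have e3 : (A ^ 2) ^ 2 ≤ (4 * D * m) * (m / 16) := by
      rw [pow_two (A ^ 2)]; exact mul_le_mul hA1 hAm (sq_nonneg _) (by positivity)
    linarith
  unfold bergmanForm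
  have f1 : ‖ξ‖ ^ 2 / (1 - ‖w‖ ^ 2) ≤ 16 * D := by
    rw [div_le_iff₀ hu0]
    have := mul_le_mul_of_nonneg_left hu (by positivity : 0 ≤ 16 * D)
    linarith
  have f2 : ‖inner ℂ w ξ‖ ^ 2 / (1 - ‖w‖ ^ 2) ^ 2 ≤ 100 * D := by
    rw [div_le_iff₀ (by positivity)]
    have : (m / 4) ^ 2 ≤ (1 - ‖w‖ ^ 2) ^ 2 := pow_le_pow_left₀ (by positivity) hu 2
    have := mul_le_mul_of_nonneg_left this (by positivity : 0 ≤ 100 * D)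
    linarith
  linarith

/-- The straight segment is a competitor, and its speed is bounded by `bergmanForm_segment_le`. -/
lemma bergmanDist_le_sqrt {n : ℕ} {x y : Cn n} (hx : x ∈ unitBall n) (hy : y ∈ unitBall n)
    (hD : 1 - kernelRatio x y ≤ 1 / 64) :
    bergmanDist x y ≤ Real.sqrt (((n : ℝ) + 1) * (116 * (1 - kernelRatio x y))) := by
  set γ : ℝ → Cn n := fun t => x + t • (y - x) with hγ
  have hc := (contDiff_segment x y).contDiffOn (s := Set.Icc (0 : ℝ) 1)
  have hb : ∀ t ∈ Set.Icc (0 : ℝ) 1, γ t ∈ unitBall n :=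
    fun t ht => segment_mem_unitBall hx hy ht
  have h1 := bergmanDist_le_bergmanLength hc hb
  simp only [zero_smul, add_zero, one_smul, add_sub_cancel] at h1
  refine h1.trans ?_
  have hd : ∀ t ∈ Set.Icc (0 : ℝ) 1, derivWithin γ (Set.Icc 0 1) t = y - x := by
    intro t ht
    have : HasDerivAt γ (y - x) t := by
      exact (((hasDerivAt_id t).smul_const (y - x)).const_add x).congr_deriv (one_smul _ _)
    exact this.hasDerivWithinAt.derivWithin (uniqueDiffOn_Icc zero_lt_one t ht)
  have hle : bergmanLength γ ≤
      ∫ t in (0 : ℝ)..1, Real.sqrt (((n : ℝ) + 1) * (116 * (1 - kernelRatio x y))) := by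
    refine intervalIntegral.integral_mono_on zero_le_one ?_ (by simp) fun t ht => ?_
    · exact (continuousOn_bergmanNorm_curve hc hb).intervalIntegrable_of_Icc zero_le_one
    · rw [bergmanNorm_eq (hb t ht), hd t ht]
      have := bergmanForm_segment_le hx hy hD ht
      exact Real.sqrt_le_sqrt (by gcongr)
  simpa using hle

/-! ### An integration by parts on the ball -/

/-- At `0` the truncated power is dominated by `|x| ^ a`, whose derivative vanishes there. The
truncation extends the vector field below by zero outside the ball as a `C¹` field, so no boundary
term arises. -/
lemma hasDerivAt_max_zero_rpow {a : ℝ} (ha : 1 < a) (x : ℝ) :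
    HasDerivAt (fun x : ℝ => (max x 0) ^ a) (a * (max x 0) ^ (a - 1)) x := by
  rcases lt_trichotomy x 0 with hx | rfl | hx
  · have h0 : (0 : ℝ) ^ (a - 1) = 0 := Real.zero_rpow (by linarith)
    have h1 : (0 : ℝ) ^ a = 0 := Real.zero_rpow (by linarith)
    rw [max_eq_right hx.le, h0, mul_zero]
    refine (hasDerivAt_const x (0 : ℝ)).congr_of_eventuallyEq ?_
    filter_upwards [Iio_mem_nhds hx] with y hy
    rw [max_eq_right (le_of_lt hy), h1]
  · have h0 : (0 : ℝ) ^ (a - 1) = 0 := Real.zero_rpow (by linarith)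
    have h1 : (0 : ℝ) ^ a = 0 := Real.zero_rpow (by linarith)
    rw [max_self, h0, mul_zero, hasDerivAt_iff_isLittleO]
    have h2 := hasDerivAt_iff_isLittleO.1 (hasDerivAt_abs_rpow (0 : ℝ) ha)
    simp only [max_self, h1, abs_zero, mul_zero, smul_zero, sub_zero] at h2 ⊢
    refine Asymptotics.IsBigO.trans_isLittleO (Asymptotics.isBigO_of_le _ fun y => ?_) h2
    have hy : max y 0 ≤ |y| := max_le (le_abs_self y) (abs_nonneg y)
    have hy0 : 0 ≤ max y 0 := le_max_right _ _
    rw [Real.norm_of_nonneg (Real.rpow_nonneg hy0 _),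
      Real.norm_of_nonneg (Real.rpow_nonneg (abs_nonneg y) _)]
    exact Real.rpow_le_rpow hy0 hy (by linarith)
  · rw [max_eq_left hx.le]
    refine (Real.hasDerivAt_rpow_const (Or.inl hx.ne')).congr_of_eventuallyEq ?_
    filter_upwards [Ioi_mem_nhds hx] with y hy
    rw [max_eq_left (le_of_lt hy)]

lemma contDiff_max_zero_rpow {a : ℝ} (ha : 1 < a) :
    ContDiff ℝ 1 (fun x : ℝ => (max x 0) ^ a) := by
  rw [contDiff_one_iff_deriv]
  refine ⟨fun x => (hasDerivAt_max_zero_rpow ha x).differentiableAt, ?_⟩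
  rw [show deriv (fun x : ℝ => (max x 0) ^ a) = fun x => a * (max x 0) ^ (a - 1) from
    funext fun x => (hasDerivAt_max_zero_rpow ha x).deriv]
  exact continuous_const.mul ((continuous_id.max continuous_const).rpow_const
    fun _ => Or.inr (by linarith))

lemma integral_fderiv_eq_zero_of_hasCompactSupport {n : ℕ} {g : Cn n → ℂ} (hg : ContDiff ℝ 1 g)
    (hs : HasCompactSupport g) (ξ : Cn n) : ∫ w, fderiv ℝ g w ξ = 0 := by
  have hc : Continuous fun w => fderiv ℝ g w ξ :=
    (hg.continuous_fderiv one_ne_zero).clm_apply continuous_const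
  have hsi : HasCompactSupport fun w => fderiv ℝ g w ξ := hs.fderiv_apply ℝ ξ
  have := integral_mul_fderiv_eq_neg_fderiv_mul_of_integrable (μ := (volume : Measure (Cn n)))
    (f := fun _ => (1 : ℂ)) (g := g) (v := ξ) (by simp)
    (by simpa using hc.integrable_of_hasCompactSupport hsi)
    (by simpa using hg.continuous.integrable_of_hasCompactSupport hs)
    (fun x _ => differentiableAt_const _) (fun x _ => hg.differentiable one_ne_zero x)
  simpa using this

/-- The scalar factor of the vector field whose divergence is integrated. -/
def fluxWeight {n : ℕ} (lam : ℝ) (z w : Cn n) : ℝ :=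
  (‖h w z‖ ^ 2) ^ (-(lam + 1)) * (max (1 - ‖w‖ ^ 2) 0) ^ (lam - n)

/-- The components of the vector field `fluxWeight • h(w, z) (w - z)`, a multiple of the image of
the Euler field under the automorphism of the ball exchanging `0` and `z`. -/
def flux {n : ℕ} (lam : ℝ) (z : Cn n) (j : Fin n) (w : Cn n) : ℂ :=
  (fluxWeight lam z w : ℂ) * (h w z * (w j - z j))

lemma contDiff_h {n : ℕ} (z : Cn n) : ContDiff ℝ 1 (fun w : Cn n => h w z) :=
  contDiff_const.sub (contDiff_const.inner ℂ contDiff_id)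

lemma contDiff_one_sub_normSq {n : ℕ} : ContDiff ℝ 1 (fun w : Cn n => 1 - ‖w‖ ^ 2) :=
  contDiff_const.sub (contDiff_id.norm_sq ℂ)

lemma hasFDerivAt_h {n : ℕ} (z w : Cn n) :
    ∃ L : Cn n →L[ℝ] ℂ, HasFDerivAt (fun w : Cn n => h w z) L w ∧ ∀ ξ, L ξ = -inner ℂ z ξ := by
  have h1 := ((hasFDerivAt_const (𝕜 := ℝ) z w).inner ℂ (hasFDerivAt_id w)).const_sub 1
  exact ⟨_, h1, fun ξ => by simp [fderivInnerCLM_apply]⟩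

lemma hasFDerivAt_fluxWeight {n : ℕ} {lam : ℝ} (hlam : 1 < lam - n) {z w : Cn n}
    (hq : h w z ≠ 0) :
    ∃ L : Cn n →L[ℝ] ℝ, HasFDerivAt (fluxWeight lam z) L w ∧ ∀ ξ, L ξ =
      2 * (lam + 1) * (‖h w z‖ ^ 2) ^ (-(lam + 2)) * (max (1 - ‖w‖ ^ 2) 0) ^ (lam - n) *
        ((starRingEnd ℂ) (h w z) * inner ℂ z ξ).re -
      2 * (lam - n) * (‖h w z‖ ^ 2) ^ (-(lam + 1)) * (max (1 - ‖w‖ ^ 2) 0) ^ (lam - n - 1) *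
        (inner ℂ w ξ).re := by
  obtain ⟨L1, hL1, hv1⟩ := hasFDerivAt_one_sub_normSq w
  obtain ⟨L2, hL2, hv2⟩ := hasFDerivAt_h z w
  have hA : 0 < ‖h w z‖ ^ 2 := by have := norm_pos_iff.2 hq; positivity
  have hd1 := (hasDerivAt_max_zero_rpow hlam (1 - ‖w‖ ^ 2)).comp_hasFDerivAt w hL1
  have hd2 := (Real.hasDerivAt_rpow_const (p := -(lam + 1)) (Or.inl hA.ne')).comp_hasFDerivAt w
    hL2.norm_sq
  refine ⟨_, hd2.mul hd1, fun ξ => ?_⟩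
  have e : -(lam + 1) - 1 = -(lam + 2) := by ring
  simp only [add_apply, smul_apply, smul_eq_mul, hv1, ContinuousLinearMap.comp_apply, hv2, e,
    Function.comp_apply, innerSL_apply_apply]
  rw [Complex.inner]
  simp only [neg_mul, Complex.neg_re, nsmul_eq_mul, Nat.cast_ofNat]
  rw [mul_comm (inner ℂ z ξ)]
  ring

lemma hasFDerivAt_flux {n : ℕ} {lam : ℝ} (hlam : 1 < lam - n) {z w : Cn n}
    (hq : h w z ≠ 0) (j : Fin n) :
    ∃ L : Cn n →L[ℝ] ℂ, HasFDerivAt (flux lam z j) L w ∧ ∀ ξ, L ξ =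
      ((2 * (lam + 1) * (‖h w z‖ ^ 2) ^ (-(lam + 2)) * (max (1 - ‖w‖ ^ 2) 0) ^ (lam - n) *
        ((starRingEnd ℂ) (h w z) * inner ℂ z ξ).re -
      2 * (lam - n) * (‖h w z‖ ^ 2) ^ (-(lam + 1)) * (max (1 - ‖w‖ ^ 2) 0) ^ (lam - n - 1) *
        (inner ℂ w ξ).re : ℝ) : ℂ) * (h w z * (w j - z j)) +
      fluxWeight lam z w * (h w z * ξ j - inner ℂ z ξ * (w j - z j)) := by
  obtain ⟨L1, hL1, hv1⟩ := hasFDerivAt_fluxWeight hlam hq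
  obtain ⟨L2, hL2, hv2⟩ := hasFDerivAt_h z w
  have hp : HasFDerivAt (fun u : Cn n => u j)
      ((EuclideanSpace.proj (𝕜 := ℂ) j).restrictScalars ℝ) w :=
    ((EuclideanSpace.proj (𝕜 := ℂ) j).restrictScalars ℝ).hasFDerivAt
  refine ⟨_, (Complex.ofRealCLM.hasFDerivAt.comp w hL1).mul (hL2.mul (hp.sub_const (z j))),
    fun ξ => ?_⟩
  simp only [add_apply, smul_apply, smul_eq_mul, hv1, ContinuousLinearMap.comp_apply, hv2,
    Function.comp_apply, Complex.ofRealCLM_apply, ContinuousLinearMap.coe_restrictScalars',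
    PiLp.proj_apply]
  ring

lemma norm_mul_norm_lt_one {n : ℕ} {z w : Cn n} (hz : z ∈ unitBall n) (hw : ‖w‖ ≤ 1) :
    ‖z‖ * ‖w‖ < 1 := by
  rw [unitBall, mem_ball_zero_iff] at hz
  nlinarith [norm_nonneg z, norm_nonneg w]

lemma fluxWeight_eq_zero {n : ℕ} {lam : ℝ} (hlam : 1 < lam - n) (z : Cn n) {w : Cn n}
    (hw : 1 ≤ ‖w‖) : fluxWeight lam z w = 0 := by
  rw [fluxWeight, max_eq_right (by nlinarith), Real.zero_rpow (by linarith), mul_zero]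

lemma contDiff_flux {n : ℕ} {lam : ℝ} (hlam : 1 < lam - n) {z : Cn n} (hz : z ∈ unitBall n)
    (j : Fin n) : ContDiff ℝ 1 (flux lam z j) := by
  rw [contDiff_iff_contDiffAt]
  intro w
  rcases le_or_gt ‖w‖ 1 with hw | hw
  · have hq := h_ne_zero_of_norm_mul_lt (norm_mul_norm_lt_one hz hw)
    have hA : ‖h w z‖ ^ 2 ≠ 0 := by have := norm_pos_iff.2 hq; positivity
    have h1 : ContDiffAt ℝ 1 (fluxWeight lam z) w :=
      (((contDiff_h z).norm_sq ℝ).contDiffAt.rpow_const_of_ne hA).mul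
        ((contDiff_max_zero_rpow hlam).comp contDiff_one_sub_normSq).contDiffAt
    have hp : ContDiff ℝ 1 (fun u : Cn n => u j) :=
      ((EuclideanSpace.proj (𝕜 := ℂ) j).restrictScalars ℝ).contDiff
    exact (Complex.ofRealCLM.contDiff.contDiffAt.comp w h1).mul
      ((contDiff_h z).mul (hp.sub contDiff_const)).contDiffAt
  · refine (contDiffAt_const (c := (0 : ℂ))).congr_of_eventuallyEq ?_
    filter_upwards [continuous_norm.continuousAt.eventually (lt_mem_nhds hw)] with u hu
    rw [flux, fluxWeight_eq_zero hlam z (le_of_lt hu)]; simp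

lemma hasCompactSupport_flux {n : ℕ} {lam : ℝ} (hlam : 1 < lam - n) (z : Cn n) (j : Fin n) :
    HasCompactSupport (flux lam z j) := by
  refine HasCompactSupport.intro (isCompact_closedBall (0 : Cn n) 1) fun w hw => ?_
  rw [mem_closedBall_zero_iff, not_le] at hw
  rw [flux, fluxWeight_eq_zero hlam z hw.le]; simp

/-- The unnormalized density of `|k_z|² dv_lam` with respect to `v`. -/
def weight {n : ℕ} (lam : ℝ) (z w : Cn n) : ℝ :=
  (‖h w z‖ ^ 2) ^ (-lam) * (1 - ‖w‖ ^ 2) ^ (lam - genus n)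

/-- The left side is twice the complex divergence `∑ ∂/∂w_j` of the flux. The exponents in
`fluxWeight` are such that the terms proportional to `h w z` cancel, their coefficient being `-(lam
+ 1) + (lam - n) + n + 1 = 0`. -/
lemma sum_wirtinger_flux {n : ℕ} {lam : ℝ} (hlam : 1 < lam - n) {z w : Cn n}
    (hz : z ∈ unitBall n) (hw : w ∈ unitBall n) :
    ∑ j, (fderiv ℝ (flux lam z j) w (EuclideanSpace.single j 1)
      - Complex.I * fderiv ℝ (flux lam z j) w (EuclideanSpace.single j Complex.I)) =
      ((2 * ((lam * kernelRatio z w - (lam - n)) * weight lam z w) : ℝ) : ℂ) := by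
  have hq := h_ne_zero hz hw
  have hu := one_sub_normSq_pos hw
  have hA := normSq_h_pos hz hw
  set q := h w z with hqdef
  set A : ℝ := ‖q‖ ^ 2 with hAdef
  set u : ℝ := 1 - ‖w‖ ^ 2 with hudef
  set W : ℝ := A ^ (-lam) * u ^ (lam - n - 1) with hW
  have hA1 : A ^ (-(lam + 1)) = A ^ (-lam) / A := by
    rw [neg_add, Real.rpow_add hA, Real.rpow_neg_one, div_eq_mul_inv]
  have hA2 : A ^ (-(lam + 2)) = A ^ (-lam) / A ^ 2 := by
    rw [neg_add, Real.rpow_add hA, Real.rpow_neg hA.le, Real.rpow_neg hA.le 2, Real.rpow_two,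
      div_eq_mul_inv]
  have hu1 : u ^ (lam - n) = u ^ (lam - n - 1) * u := by
    rw [Real.rpow_sub_one hu.ne', div_mul_cancel₀ _ hu.ne']
  have hfw : fluxWeight lam z w = W * u / A := by
    rw [fluxWeight, ← hqdef, ← hudef, max_eq_left hu.le, ← hAdef, hA1, hu1, hW]; ring
  have hwt : weight lam z w = W := by
    rw [weight, genus, hW, sub_add_eq_sub_sub]
  have key : ∀ j, fderiv ℝ (flux lam z j) w (EuclideanSpace.single j 1)
      - Complex.I * fderiv ℝ (flux lam z j) w (EuclideanSpace.single j Complex.I) =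
      2 * (lam + 1) * (W * u / A ^ 2) * ((starRingEnd ℂ) q * q) *
        ((starRingEnd ℂ) (z j) * (w j - z j)) -
      2 * (lam - n) * (W / A) * q * ((starRingEnd ℂ) (w j) * (w j - z j)) +
      2 * (W * u / A) * (q - (starRingEnd ℂ) (z j) * (w j - z j)) := by
    intro j
    obtain ⟨L, hL, hv⟩ := hasFDerivAt_flux hlam hq j
    have e1 : ∀ c : ℂ, (((c * (starRingEnd ℂ) (z j)).re : ℝ) : ℂ) -
        Complex.I * (((c * (Complex.I * (starRingEnd ℂ) (z j))).re : ℝ) : ℂ) =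
        c * (starRingEnd ℂ) (z j) := fun c => by
      rw [mul_left_comm, Complex.I_mul_re]
      conv_rhs => rw [← Complex.re_add_im (c * (starRingEnd ℂ) (z j))]
      push_cast; ring
    have e2 : ((((starRingEnd ℂ) (w j)).re : ℝ) : ℂ) -
        Complex.I * (((Complex.I * (starRingEnd ℂ) (w j)).re : ℝ) : ℂ) =
        (starRingEnd ℂ) (w j) := by
      rw [Complex.I_mul_re]
      conv_rhs => rw [← Complex.re_add_im ((starRingEnd ℂ) (w j))]
      push_cast; ring
    rw [hL.fderiv, hv, hv, hfw]
    simp only [← hqdef, ← hAdef, ← hudef, max_eq_left hu.le, hA1, hA2, hu1,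
      EuclideanSpace.inner_single_right, one_mul, PiLp.single_apply, if_true]
    have e3 := e1 ((starRingEnd ℂ) q)
    rw [hW]
    push_cast
    set X : ℂ := ((((starRingEnd ℂ) q * (starRingEnd ℂ) (z j)).re : ℝ) : ℂ)
    set Y : ℂ := ((((starRingEnd ℂ) q * (Complex.I * (starRingEnd ℂ) (z j))).re : ℝ) : ℂ)
    set X' : ℂ := ((((starRingEnd ℂ) (w j)).re : ℝ) : ℂ)
    set Y' : ℂ := (((Complex.I * (starRingEnd ℂ) (w j)).re : ℝ) : ℂ)
    generalize ((A ^ (-lam) : ℝ) : ℂ) = a at *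
    generalize ((u ^ (lam - n - 1) : ℝ) : ℂ) = b at *
    linear_combination (2 * ((lam : ℂ) + 1) * (a / A ^ 2) * (b * u) * (q * (w j - z j))) * e3
      - (2 * ((lam : ℂ) - n) * (a / A) * b * (q * (w j - z j))) * e2
      - (a * b * u / A * (q - (starRingEnd ℂ) (z j) * (w j - z j))) * Complex.I_mul_I
  rw [Finset.sum_congr rfl fun j _ => key j]
  have hin : ∀ x : Cn n, ∑ j, (starRingEnd ℂ) (x j) * (w j - z j) = inner ℂ x (w - z) := by
    intro x
    rw [PiLp.inner_apply]
    exact Finset.sum_congr rfl fun i _ => by simp [mul_comm]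
  rw [Finset.sum_add_distrib, Finset.sum_sub_distrib, ← Finset.mul_sum, ← Finset.mul_sum,
    ← Finset.mul_sum, Finset.sum_sub_distrib, hin, hin, inner_sub_right_eq]
  have hinw : inner ℂ w (w - z) = (starRingEnd ℂ) q - u := by
    rw [inner_sub_right, inner_self_ofReal, hqdef, conj_h, h, hudef]; push_cast; ring
  have hqq : (starRingEnd ℂ) q * q = A := by
    rw [Complex.conj_mul', hAdef]; push_cast; rfl
  rw [hinw, hwt, kernelRatio, ← hqdef, ← hAdef, ← hudef, Finset.sum_const, Finset.card_univ,
    Fintype.card_fin, nsmul_eq_mul, hqq]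
  set m : ℝ := 1 - ‖z‖ ^ 2
  have hA' : (A : ℂ) ≠ 0 := by exact_mod_cast hA.ne'
  push_cast
  field_simp
  linear_combination (-((lam : ℂ) - n)) * W * hqq

/-- The divergence of a compactly supported `C¹` field has integral zero, and it lives on the ball.
-/
lemma integral_weight_identity {n : ℕ} {lam : ℝ} (hlam : 1 < lam - n) {z : Cn n}
    (hz : z ∈ unitBall n) :
    ∫ w in unitBall n, (lam * kernelRatio z w - (lam - n)) * weight lam z w = 0 := by
  have h0 : ∀ j ξ, Integrable (fun w => fderiv ℝ (flux lam z j) w ξ) := fun j ξ =>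
    (((contDiff_flux hlam hz j).continuous_fderiv one_ne_zero).clm_apply
      continuous_const).integrable_of_hasCompactSupport
        ((hasCompactSupport_flux hlam z j).fderiv_apply ℝ ξ)
  have h1 : ∫ w, ∑ j, (fderiv ℝ (flux lam z j) w (EuclideanSpace.single j 1)
      - Complex.I * fderiv ℝ (flux lam z j) w (EuclideanSpace.single j Complex.I)) = 0 := by
    rw [integral_finsetSum _ fun j _ => by exact (h0 j _).sub ((h0 j _).const_mul _)]
    refine Finset.sum_eq_zero fun j _ => ?_
    rw [integral_sub (h0 j _) ((h0 j _).const_mul _), integral_const_mul,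
      integral_fderiv_eq_zero_of_hasCompactSupport (contDiff_flux hlam hz j)
        (hasCompactSupport_flux hlam z j),
      integral_fderiv_eq_zero_of_hasCompactSupport (contDiff_flux hlam hz j)
        (hasCompactSupport_flux hlam z j)]
    simp
  -- On the sphere itself the derivative vanishes because `lam - n - 1` is still positive.
  have h2 : ∀ w, w ∉ unitBall n → ∀ j, fderiv ℝ (flux lam z j) w = 0 := by
    intro w hw j
    rw [unitBall, mem_ball_zero_iff, not_lt] at hw
    rcases hw.eq_or_lt with hw1 | hw1
    · obtain ⟨L, hL, hv⟩ := hasFDerivAt_flux hlam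
        (h_ne_zero_of_norm_mul_lt (norm_mul_norm_lt_one hz hw1.symm.le)) j
      rw [hL.fderiv]
      ext ξ
      rw [hv, fluxWeight_eq_zero hlam z hw, max_eq_right (by nlinarith),
        Real.zero_rpow (by linarith), Real.zero_rpow (by linarith)]
      simp
    · have : flux lam z j =ᶠ[𝓝 w] fun _ => 0 := by
        filter_upwards [continuous_norm.continuousAt.eventually (lt_mem_nhds hw1)] with u hu
        rw [flux, fluxWeight_eq_zero hlam z (le_of_lt hu)]; simp
      rw [this.fderiv_eq]; simp
  rw [← setIntegral_eq_integral_of_forall_compl_eq_zero (s := unitBall n)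
    (fun w hw => by simp [h2 w hw]),
    setIntegral_congr_fun (isOpen_unitBall n).measurableSet
      fun w hw => sum_wirtinger_flux hlam hz hw, integral_complex_ofReal, integral_const_mul] at h1
  have h3 := Complex.ofReal_eq_zero.1 h1
  linarith

/-! ### The Berezin transform as a weighted average -/

lemma volume_unitBall_pos (n : ℕ) : 0 < volume (unitBall n) :=
  Metric.measure_ball_pos _ _ one_pos

lemma volume_unitBall_lt_top (n : ℕ) : volume (unitBall n) < ⊤ := measure_ball_lt_top

instance isProbabilityMeasure_v (n : ℕ) : IsProbabilityMeasure (v n) := ⟨by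
  rw [v, Measure.smul_apply, Measure.restrict_apply_univ, smul_eq_mul,
    ENNReal.inv_mul_cancel (volume_unitBall_pos n).ne' (volume_unitBall_lt_top n).ne]⟩

lemma ae_mem_unitBall (n : ℕ) : ∀ᵐ w ∂(v n), w ∈ unitBall n :=
  Measure.ae_smul_measure (ae_restrict_mem (isOpen_unitBall n).measurableSet) _

lemma v_unitBall (n : ℕ) : v n (unitBall n) = 1 := by
  rw [prob_compl_eq_zero_iff (isOpen_unitBall n).measurableSet |>.symm]
  exact ae_mem_unitBall n

lemma weight_pos {n : ℕ} (lam : ℝ) {z w : Cn n} (hz : z ∈ unitBall n) (hw : w ∈ unitBall n) :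
    0 < weight lam z w :=
  mul_pos (Real.rpow_pos_of_pos (normSq_h_pos hz hw) _)
    (Real.rpow_pos_of_pos (one_sub_normSq_pos hw) _)

/-- Up to a factor depending only on `z`, this is a power of the invariant `kernelRatio` against the
invariant measure `(1 - ‖w‖²)^(-(n + 1)) dv`, which is what localizes the mass near `z`. -/
lemma weight_eq {n : ℕ} (lam : ℝ) {z w : Cn n} (hz : z ∈ unitBall n) (hw : w ∈ unitBall n) :
    weight lam z w = kernelRatio z w ^ lam /
      ((1 - ‖z‖ ^ 2) ^ lam * (1 - ‖w‖ ^ 2) ^ (n + 1)) := by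
  have hm := one_sub_normSq_pos hz
  have hu := one_sub_normSq_pos hw
  have hA := normSq_h_pos hz hw
  have e : (1 - ‖w‖ ^ 2) ^ (lam - genus n) =
      (1 - ‖w‖ ^ 2) ^ lam / (1 - ‖w‖ ^ 2) ^ (n + 1) := by
    rw [Real.rpow_sub hu, genus]; congr 1; exact_mod_cast Real.rpow_natCast _ (n + 1)
  rw [weight, e, kernelRatio, Real.div_rpow (by positivity) hA.le, Real.mul_rpow hm.le hu.le,
    Real.rpow_neg hA.le]
  have := (Real.rpow_pos_of_pos hm lam).ne'
  have := (Real.rpow_pos_of_pos hA lam).ne'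
  field_simp

lemma integrable_v_of_continuousOn {n : ℕ} {E : Type*} [NormedAddCommGroup E] {g : Cn n → E}
    (hg : ContinuousOn g (Metric.closedBall 0 1)) : Integrable g (v n) := by
  have h1 : IntegrableOn g (unitBall n) :=
    (hg.integrableOn_compact (isCompact_closedBall _ _)).mono_set Metric.ball_subset_closedBall
  exact h1.smul_measure (ENNReal.inv_ne_top.2 (volume_unitBall_pos n).ne')

lemma integrable_weight {n : ℕ} {lam : ℝ} (hlam : genus n ≤ lam) {z : Cn n}
    (hz : z ∈ unitBall n) : Integrable (weight lam z) (v n) := by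
  refine integrable_v_of_continuousOn (ContinuousOn.mul ?_ ?_)
  · refine ((contDiff_h z).continuous.norm.pow 2).continuousOn.rpow_const fun w hw => Or.inl ?_
    rw [mem_closedBall_zero_iff] at hw
    exact pow_ne_zero 2 (norm_ne_zero_iff.2
      (h_ne_zero_of_norm_mul_lt (norm_mul_norm_lt_one hz hw)))
  · exact (continuous_const.sub (continuous_norm.pow 2)).continuousOn.rpow_const
      fun w _ => Or.inr (sub_nonneg.2 hlam)

lemma integral_weight_pos {n : ℕ} {lam : ℝ} (hlam : genus n ≤ lam) {z : Cn n}
    (hz : z ∈ unitBall n) : 0 < ∫ w, weight lam z w ∂(v n) := by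
  rw [integral_pos_iff_support_of_nonneg_ae _ (integrable_weight hlam hz)]
  · refine lt_of_lt_of_le ?_ (measure_mono (s := unitBall n) fun w hw => (weight_pos lam hz hw).ne')
    rw [v_unitBall]; exact one_pos
  · filter_upwards [ae_mem_unitBall n] with w hw using (weight_pos lam hz hw).le

lemma zero_mem_unitBall (n : ℕ) : (0 : Cn n) ∈ unitBall n := Metric.mem_ball_self one_pos

lemma c_pos {n : ℕ} {lam : ℝ} (hlam : genus n ≤ lam) : 0 < c n lam := by
  have := integral_weight_pos hlam (zero_mem_unitBall n)
  simp only [weight, h, inner_zero_left, sub_zero, norm_one, one_pow, Real.one_rpow, one_mul]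
    at this
  exact inv_pos.2 this

lemma integral_vWeighted {n : ℕ} {lam : ℝ} (hlam : genus n ≤ lam) {E : Type*}
    [NormedAddCommGroup E] [NormedSpace ℝ E] (g : Cn n → E) :
    ∫ w, g w ∂(vWeighted n lam) =
      ∫ w, (c n lam * (1 - ‖w‖ ^ 2) ^ (lam - genus n)) • g w ∂(v n) := by
  have hmeas : Measurable fun w : Cn n => c n lam * (1 - ‖w‖ ^ 2) ^ (lam - genus n) :=
    ((measurable_const.sub (measurable_norm.pow_const 2)).pow_const _).const_mul _
  rw [vWeighted, integral_withDensity_eq_integral_toReal_smul hmeas.ennreal_ofReal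
    (Eventually.of_forall fun _ => ENNReal.ofReal_lt_top)]
  refine integral_congr_ae ?_
  filter_upwards [ae_mem_unitBall n] with w hw
  rw [ENNReal.toReal_ofReal (mul_nonneg (c_pos hlam).le
    (Real.rpow_nonneg (one_sub_normSq_pos hw).le _))]

lemma normSq_K {n : ℕ} (lam : ℝ) (z w : Cn n) : ‖K lam w z‖ ^ 2 = (‖h w z‖ ^ 2) ^ (-lam) := by
  rw [K, ← Complex.ofReal_neg, Complex.norm_cpow_real, ← Real.rpow_natCast, ← Real.rpow_mul
    (norm_nonneg _), mul_comm, Real.rpow_mul (norm_nonneg _), Real.rpow_natCast]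

/-- The probability density of `|k_z|² dv_lam` with respect to `v`. -/
def density {n : ℕ} (lam : ℝ) (z w : Cn n) : ℝ :=
  weight lam z w / ∫ u, weight lam z u ∂(v n)

/-- The constant `c n lam` occurs both in the measure and in the squared norm of the kernel and
cancels, so neither needs a closed form. -/
lemma berezin_eq {n : ℕ} {lam : ℝ} (hlam : genus n ≤ lam) {z : Cn n} (hz : z ∈ unitBall n)
    (f : Cn n → ℂ) :
    berezin lam f z = ∫ w, f w * (density lam z w : ℂ) ∂(v n) := by
  have hc := c_pos hlam
  have hZ := integral_weight_pos hlam hz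
  have hI : ∫ u, ‖K lam u z‖ ^ 2 ∂(vWeighted n lam) = c n lam * ∫ w, weight lam z w ∂(v n) := by
    rw [integral_vWeighted hlam, ← integral_const_mul]
    refine integral_congr_ae (Eventually.of_forall fun w => ?_)
    simp only [normSq_K, weight, smul_eq_mul]
    ring
  rw [berezin, integral_vWeighted hlam]
  refine integral_congr_ae (Eventually.of_forall fun w => ?_)
  have hk : ‖k lam z w‖ ^ 2 =
      (‖h w z‖ ^ 2) ^ (-lam) / (c n lam * ∫ w, weight lam z w ∂(v n)) := by
    rw [k, norm_div, div_pow, normSq_K, Complex.norm_of_nonneg (Real.sqrt_nonneg _), hI,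
      Real.sq_sqrt (by positivity)]
  simp only [hk, density, weight, Complex.real_smul]
  set Z := ∫ u, (‖h u z‖ ^ 2) ^ (-lam) * (1 - ‖u‖ ^ 2) ^ (lam - genus n) ∂(v n) with hZdef
  have hZ' : (Z : ℂ) ≠ 0 := by exact_mod_cast hZ.ne'
  have hc' : (c n lam : ℂ) ≠ 0 := by exact_mod_cast hc.ne'
  push_cast
  field_simp

lemma density_nonneg {n : ℕ} {lam : ℝ} (hlam : genus n ≤ lam) {z w : Cn n}
    (hz : z ∈ unitBall n) (hw : w ∈ unitBall n) : 0 ≤ density lam z w :=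
  div_nonneg (weight_pos lam hz hw).le (integral_weight_pos hlam hz).le

lemma integrable_density {n : ℕ} {lam : ℝ} (hlam : genus n ≤ lam) {z : Cn n}
    (hz : z ∈ unitBall n) : Integrable (density lam z) (v n) :=
  (integrable_weight hlam hz).div_const _

lemma integral_density {n : ℕ} {lam : ℝ} (hlam : genus n ≤ lam) {z : Cn n}
    (hz : z ∈ unitBall n) : ∫ w, density lam z w ∂(v n) = 1 := by
  unfold density
  rw [integral_div, div_self (integral_weight_pos hlam hz).ne']

lemma measurable_kernelRatio {n : ℕ} (z : Cn n) : Measurable (kernelRatio z) :=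
  (measurable_const.mul (measurable_const.sub (measurable_norm.pow_const 2))).div
    ((contDiff_h z).continuous.norm.pow 2).measurable

lemma integrable_kernelRatio_mul_density {n : ℕ} {lam : ℝ} (hlam : genus n ≤ lam) {z : Cn n}
    (hz : z ∈ unitBall n) :
    Integrable (fun w => (1 - kernelRatio z w) * density lam z w) (v n) := by
  refine (integrable_density hlam hz).bdd_mul (c := 1)
    (measurable_const.sub (measurable_kernelRatio z)).aestronglyMeasurable ?_
  filter_upwards [ae_mem_unitBall n] with w hw
  have := kernelRatio_pos hz hw
  have := kernelRatio_le_one hz hw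
  rw [Real.norm_eq_abs, abs_le]
  constructor <;> linarith

/-- The mean of `1 - kernelRatio z` with respect to `|k_z|² dv_lam` is `n / lam`. -/
lemma integral_one_sub_kernelRatio_mul_density {n : ℕ} {lam : ℝ} (hlam : genus n < lam)
    {z : Cn n} (hz : z ∈ unitBall n) :
    ∫ w, (1 - kernelRatio z w) * density lam z w ∂(v n) = n / lam := by
  have hl : 1 < lam - n := by rw [genus] at hlam; linarith
  have hl0 : 0 < lam := by have : (0 : ℝ) ≤ n := n.cast_nonneg; linarith
  have h1 : ∫ w, (lam * kernelRatio z w - (lam - n)) * weight lam z w ∂(v n) = 0 := by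
    rw [v, integral_smul_measure, integral_weight_identity hl hz, smul_zero]
  have hZ := integral_weight_pos hlam.le hz
  have h2 : ∫ w, (n * density lam z w - lam * ((1 - kernelRatio z w) * density lam z w)) ∂(v n)
      = 0 := by
    rw [← zero_div (∫ u, weight lam z u ∂(v n)), ← h1, ← integral_div]
    refine integral_congr_ae (Eventually.of_forall fun w => ?_)
    simp only [density]; ring
  rw [integral_sub ((integrable_density hlam.le hz).const_mul _)
    ((integrable_kernelRatio_mul_density hlam.le hz).const_mul _), integral_const_mul,
    integral_const_mul, integral_density hlam.le hz] at h2
  rw [eq_div_iff hl0.ne']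
  linarith

/-- The variance of a bounded function with respect to a probability density is at most its mean
square distance to any constant. -/
lemma re_integral_normSq_sub_le {α : Type*} [MeasurableSpace α] {ν : Measure α} {f : α → ℂ}
    {P : α → ℝ} (hP : Integrable P ν) (hP1 : ∫ x, P x ∂ν = 1) (hf : AEStronglyMeasurable f ν)
    {M : ℝ} (hM : ∀ᵐ x ∂ν, ‖f x‖ ≤ M) (a : ℂ) :
    (∫ x, ((‖f x‖ ^ 2 : ℝ) : ℂ) * (P x : ℂ) ∂ν).re - ‖∫ x, f x * (P x : ℂ) ∂ν‖ ^ 2 ≤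
      ∫ x, ‖f x - a‖ ^ 2 * P x ∂ν := by
  have hfP : Integrable (fun x => f x * (P x : ℂ)) ν := hP.ofReal.bdd_mul hf hM
  have hf2P : Integrable (fun x => ‖f x‖ ^ 2 * P x) ν := by
    refine hP.bdd_mul (c := M ^ 2) (hf.norm.pow 2) ?_
    filter_upwards [hM] with x hx
    rw [Real.norm_of_nonneg (by positivity)]
    exact pow_le_pow_left₀ (norm_nonneg _) hx 2
  have e1 : (∫ x, ((‖f x‖ ^ 2 : ℝ) : ℂ) * (P x : ℂ) ∂ν).re = ∫ x, ‖f x‖ ^ 2 * P x ∂ν := by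
    rw [← Complex.ofReal_re (∫ x, ‖f x‖ ^ 2 * P x ∂ν), ← integral_complex_ofReal]
    simp only [Complex.ofReal_mul]
  have hcf : Integrable (fun x => (starRingEnd ℂ) a * (f x * (P x : ℂ))) ν := hfP.const_mul _
  have e2 : ∫ x, ‖f x - a‖ ^ 2 * P x ∂ν = ∫ x, ‖f x‖ ^ 2 * P x ∂ν -
      2 * ((starRingEnd ℂ) a * ∫ x, f x * (P x : ℂ) ∂ν).re + ‖a‖ ^ 2 := by
    have e3 : ((starRingEnd ℂ) a * ∫ x, f x * (P x : ℂ) ∂ν).re =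
        ∫ x, ((starRingEnd ℂ) a * (f x * (P x : ℂ))).re ∂ν := by
      rw [← integral_const_mul]
      exact (Complex.reCLM.integral_comp_comm hcf).symm
    have e4 : ‖a‖ ^ 2 = ∫ x, ‖a‖ ^ 2 * P x ∂ν := by rw [integral_const_mul, hP1, mul_one]
    have hre : Integrable (fun x => 2 * ((starRingEnd ℂ) a * (f x * (P x : ℂ))).re) ν :=
      hcf.re.const_mul 2
    rw [e3, e4, ← integral_const_mul, ← integral_sub hf2P hre,
      ← integral_add (by exact hf2P.sub hre) (hP.const_mul _)]
    refine integral_congr_ae (Eventually.of_forall fun x => ?_)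
    simp only [← Complex.normSq_eq_norm_sq, Complex.normSq_apply, Complex.sub_re, Complex.sub_im,
      Complex.mul_re, Complex.mul_im, Complex.conj_re, Complex.conj_im, Complex.ofReal_re,
      Complex.ofReal_im]
    ring
  set J := ∫ x, f x * (P x : ℂ) ∂ν
  have e5 : 0 ≤ ‖J‖ ^ 2 - 2 * ((starRingEnd ℂ) a * J).re + ‖a‖ ^ 2 := by
    have : 0 ≤ ‖J - a‖ ^ 2 := by positivity
    refine this.trans (le_of_eq ?_)
    simp only [← Complex.normSq_eq_norm_sq, Complex.normSq_apply, Complex.sub_re, Complex.sub_im,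
      Complex.mul_re, Complex.conj_re, Complex.conj_im]
    ring
  rw [e1, e2]
  linarith

lemma MO_le {n : ℕ} {lam : ℝ} (hlam : genus n ≤ lam) {z : Cn n} (hz : z ∈ unitBall n)
    {f : Cn n → ℂ} (hf : AEStronglyMeasurable f (v n)) {M : ℝ} (hM : ∀ᵐ x ∂(v n), ‖f x‖ ≤ M)
    (a : ℂ) : MO lam f z ≤ ∫ w, ‖f w - a‖ ^ 2 * density lam z w ∂(v n) := by
  rw [MO, berezin_eq hlam hz, berezin_eq hlam hz]
  exact re_integral_normSq_sub_le (integrable_density hlam hz) (integral_density hlam hz) hf hM a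

/-! ### The estimate of the mean oscillation -/

/-- On the set where `kernelRatio z` is at least `3 / 4`, the density of `|k_z|² dv_lam` is
bounded by a multiple of the reciprocal of the measure of the Bergman ball. -/
lemma exists_density_bound {n : ℕ} {lam ρ : ℝ} (hlam : genus n ≤ lam) (hρ0 : 0 < ρ)
    (hρ : ρ ≤ 1 / 2) {z : Cn n} (hz : z ∈ unitBall n) :
    ∃ C : ℝ, 0 ≤ C ∧
      (∀ w ∈ unitBall n, 1 - kernelRatio z w ≤ 1 / 4 → density lam z w ≤ C) ∧
      C * (v n).real (bergmanBall z ρ) ≤ 9 ^ (n + 1) * Real.exp (lam * ρ ^ 2) := by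
  have hl0 : 0 ≤ lam := by
    have : (0 : ℝ) ≤ n := n.cast_nonneg
    rw [genus] at hlam; linarith
  have hm := one_sub_normSq_pos hz
  set m : ℝ := 1 - ‖z‖ ^ 2 with hmdef
  have hZ := integral_weight_pos hlam hz
  set Z : ℝ := ∫ u, weight lam z u ∂(v n) with hZdef
  have hml : 0 < m ^ lam := Real.rpow_pos_of_pos hm _
  -- A measurable superset of the Bergman ball, so that measurability of the latter is never needed.
  set S : Set (Cn n) := unitBall n ∩ {w | Real.exp (-ρ ^ 2) ≤ kernelRatio z w} with hS
  have hSm : MeasurableSet S := (isOpen_unitBall n).measurableSet.inter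
    (measurableSet_le measurable_const (measurable_kernelRatio z))
  have hES : bergmanBall z ρ ⊆ S := fun w hw => by
    refine ⟨hw.1, ?_⟩
    have := neg_log_kernelRatio_le hz hw.1 hw.2
    exact (Real.le_log_iff_exp_le (kernelRatio_pos hz hw.1)).1 (by linarith)
  set b : ℝ := Real.exp (-(lam * ρ ^ 2)) / (m ^ lam * (3 * m) ^ (n + 1)) with hb
  have hb0 : 0 ≤ b := by positivity
  have hlow : ∀ w ∈ S, b ≤ weight lam z w := by
    intro w hw
    have hu := one_sub_normSq_pos hw.1
    have hT := kernelRatio_pos hz hw.1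
    -- Here `ρ ≤ 1 / 2` enters: `1 - exp (-ρ²) ≤ ρ² ≤ 1 / 4`.
    have hD : 1 - kernelRatio w z ≤ 1 / 4 := by
      have h1 : Real.exp (-ρ ^ 2) ≤ kernelRatio z w := hw.2
      have h2 := Real.add_one_le_exp (-ρ ^ 2)
      rw [kernelRatio_comm]
      nlinarith
    have h3 := one_sub_normSq_le_three_mul hw.1 hz hD
    rw [weight_eq lam hz hw.1, hb]
    have h4 : Real.exp (-(lam * ρ ^ 2)) ≤ kernelRatio z w ^ lam := by
      rw [← mul_neg, mul_comm, Real.exp_mul]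
      exact Real.rpow_le_rpow (Real.exp_pos _).le hw.2 hl0
    gcongr
  have hZlow : b * (v n).real (bergmanBall z ρ) ≤ Z := by
    calc b * (v n).real (bergmanBall z ρ) ≤ b * (v n).real S :=
          mul_le_mul_of_nonneg_left (measureReal_mono hES) hb0
      _ = ∫ _ in S, b ∂(v n) := by rw [setIntegral_const, smul_eq_mul, mul_comm]
      _ ≤ ∫ w in S, weight lam z w ∂(v n) :=
          setIntegral_mono_on (integrable_const _) (integrable_weight hlam hz).integrableOn hSm hlow
      _ ≤ Z := setIntegral_le_integral (integrable_weight hlam hz) (by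
          filter_upwards [ae_mem_unitBall n] with w hw using (weight_pos lam hz hw).le)
  -- Upper bound of the weight over its integral. Comparing `m / 3` here with `3 * m` in `b`
  -- produces `9 ^ (n + 1)`.
  refine ⟨1 / (m ^ lam * (m / 3) ^ (n + 1)) / Z, by positivity, fun w hw hD => ?_, ?_⟩
  · have hu := one_sub_normSq_pos hw
    have h3 := one_sub_normSq_le_three_mul hz hw hD
    have h4 : m / 3 ≤ 1 - ‖w‖ ^ 2 := by linarith
    rw [density, weight_eq lam hz hw]
    have h5 : kernelRatio z w ^ lam ≤ 1 :=
      Real.rpow_le_one (kernelRatio_pos hz hw).le (kernelRatio_le_one hz hw) hl0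
    gcongr
  · have e : 1 / (m ^ lam * (m / 3) ^ (n + 1)) = 9 ^ (n + 1) * Real.exp (lam * ρ ^ 2) * b := by
      rw [hb, Real.exp_neg, div_pow, mul_pow, show (9 : ℝ) = 3 * 3 by norm_num, mul_pow]
      have := (Real.exp_pos (lam * ρ ^ 2)).ne'
      field_simp
    rw [e, div_mul_eq_mul_div, div_le_iff₀ hZ, mul_assoc]
    exact mul_le_mul_of_nonneg_left hZlow (by positivity)

lemma norm_ballAverage_le {n : ℕ} {f : Cn n → ℂ} {M : ℝ} (hM0 : 0 ≤ M)
    (hM : ∀ᵐ x ∂(v n), ‖f x‖ ≤ M) (ρ : ℝ) (z : Cn n) : ‖ballAverage f ρ z‖ ≤ M := by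
  rw [ballAverage, setAverage_eq, norm_smul, norm_inv, Real.norm_of_nonneg measureReal_nonneg]
  have h1 : ‖∫ x in bergmanBall z ρ, f x ∂(v n)‖ ≤ M * (v n).real (bergmanBall z ρ) := by
    have := norm_integral_le_of_norm_le_const (μ := (v n).restrict (bergmanBall z ρ))
      (ae_restrict_of_ae hM)
    rwa [measureReal_restrict_apply_univ] at this
  -- If the ball were null, the average would be `0` by convention.
  rcases measureReal_nonneg.eq_or_lt with h0 | h0
  · rw [← h0, inv_zero, zero_mul]; exact hM0
  · rw [inv_mul_le_iff₀ h0, mul_comm]; exact h1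

lemma A2_nonneg {n : ℕ} (f : Cn n → ℂ) (ρ : ℝ) (z : Cn n) : 0 ≤ A2 f ρ z := by
  rw [A2, setAverage_eq]
  exact smul_nonneg (inv_nonneg.2 measureReal_nonneg) (integral_nonneg fun _ => by positivity)

/-- Split at `1 - kernelRatio z w = δ`. Below `δ` the point lies in the Bergman ball and the density
bound applies; above `δ`, Markov's inequality inserts the factor `(1 - kernelRatio z w) / δ ≥ 1`,
whose mean is known. -/
lemma MO_le_A2_add {n : ℕ} {lam ρ : ℝ} (hlam : genus n < lam) (hρ0 : 0 < ρ)
    (hρ : ρ ≤ 1 / 2) {z : Cn n} (hz : z ∈ unitBall n) {f : Cn n → ℂ}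
    (hf : AEStronglyMeasurable f (v n)) {M : ℝ} (hM0 : 0 ≤ M)
    (hM : ∀ᵐ x ∂(v n), ‖f x‖ ≤ M) :
    MO lam f z ≤ 9 ^ (n + 1) * Real.exp (lam * ρ ^ 2) * A2 f ρ z +
      4 * M ^ 2 / (ρ ^ 2 / (116 * ((n : ℝ) + 1))) * (n / lam) := by
  obtain ⟨C, hC0, hC, hCE⟩ := exists_density_bound hlam.le hρ0 hρ hz
  have hn0 : (0 : ℝ) ≤ n := n.cast_nonneg
  -- The threshold at which the bound of `bergmanDist_le_sqrt` equals `ρ`.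
  set δ : ℝ := ρ ^ 2 / (116 * ((n : ℝ) + 1)) with hδ
  have hδ0 : 0 < δ := by positivity
  have hδ1 : δ ≤ 1 / 64 := by
    rw [hδ, div_le_iff₀ (by positivity)]; nlinarith
  set a := ballAverage f ρ z with ha
  have hfa : ∀ᵐ x ∂(v n), ‖f x - a‖ ^ 2 ≤ 4 * M ^ 2 := by
    filter_upwards [hM] with x hx
    have : ‖f x - a‖ ≤ 2 * M := by
      have := norm_sub_le (f x) a
      have := norm_ballAverage_le hM0 hM ρ z
      linarith
    calc ‖f x - a‖ ^ 2 ≤ (2 * M) ^ 2 := pow_le_pow_left₀ (norm_nonneg _) this 2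
      _ = _ := by ring
  have hgm : AEStronglyMeasurable (fun x => ‖f x - a‖ ^ 2) (v n) :=
    (hf.sub aestronglyMeasurable_const).norm.pow 2
  have hnn : ∀ᵐ x ∂(v n), ‖‖f x - a‖ ^ 2‖ ≤ 4 * M ^ 2 := by
    filter_upwards [hfa] with x hx
    rwa [Real.norm_of_nonneg (by positivity)]
  have hgi : Integrable (fun x => ‖f x - a‖ ^ 2) (v n) := Integrable.of_bound hgm _ hnn
  have hgP : Integrable (fun x => ‖f x - a‖ ^ 2 * density lam z x) (v n) :=
    (integrable_density hlam.le hz).bdd_mul hgm hnn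
  set S : Set (Cn n) := unitBall n ∩ {w | 1 - kernelRatio z w < δ} with hS
  have hSm : MeasurableSet S := (isOpen_unitBall n).measurableSet.inter
    (measurableSet_lt (measurable_const.sub (measurable_kernelRatio z)) measurable_const)
  have hSE : S ⊆ bergmanBall z ρ := fun w hw => by
    have hD : 1 - kernelRatio z w < δ := hw.2
    refine ⟨hw.1, (bergmanDist_le_sqrt hz hw.1 (by linarith)).trans_lt ?_⟩
    rw [Real.sqrt_lt' hρ0]
    rw [hδ, lt_div_iff₀ (by positivity)] at hD
    linarith
  have hpt : ∀ᵐ w ∂(v n), ‖f w - a‖ ^ 2 * density lam z w ≤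
      C * S.indicator (fun x => ‖f x - a‖ ^ 2) w +
        4 * M ^ 2 / δ * ((1 - kernelRatio z w) * density lam z w) := by
    filter_upwards [hfa, ae_mem_unitBall n] with w hw hwb
    have hP := density_nonneg hlam.le hz hwb
    have hD := kernelRatio_le_one hz hwb
    by_cases hwS : w ∈ S
    · have hD2 : 1 - kernelRatio z w < δ := hwS.2
      have h1 := hC w hwb (by linarith)
      rw [Set.indicator_of_mem hwS, mul_comm]
      have h2 : 0 ≤ 4 * M ^ 2 / δ * ((1 - kernelRatio z w) * density lam z w) :=
        mul_nonneg (by positivity) (mul_nonneg (by linarith) hP)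
      have h3 := mul_le_mul_of_nonneg_right h1 (sq_nonneg ‖f w - a‖)
      linarith
    · have hD2 : δ ≤ 1 - kernelRatio z w := not_lt.1 fun hlt => hwS ⟨hwb, hlt⟩
      rw [Set.indicator_of_notMem hwS, mul_zero, zero_add, div_mul_eq_mul_div, le_div_iff₀ hδ0]
      calc ‖f w - a‖ ^ 2 * density lam z w * δ ≤ 4 * M ^ 2 * density lam z w *
            (1 - kernelRatio z w) := by gcongr
        _ = _ := by ring
  have hE : ∫ x in bergmanBall z ρ, ‖f x - a‖ ^ 2 ∂(v n) =
      (v n).real (bergmanBall z ρ) * A2 f ρ z := by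
    rw [A2, ← smul_eq_mul, measure_smul_setAverage _ (measure_ne_top _ _)]
  have hSint : ∫ x in S, ‖f x - a‖ ^ 2 ∂(v n) ≤ ∫ x in bergmanBall z ρ, ‖f x - a‖ ^ 2 ∂(v n) :=
    setIntegral_mono_set hgi.integrableOn (Eventually.of_forall fun x => by positivity)
      (Eventually.of_forall hSE)
  have hki := integrable_kernelRatio_mul_density hlam.le hz
  calc MO lam f z ≤ ∫ w, ‖f w - a‖ ^ 2 * density lam z w ∂(v n) := MO_le hlam.le hz hf hM a
    _ ≤ ∫ w, (C * S.indicator (fun x => ‖f x - a‖ ^ 2) w +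
        4 * M ^ 2 / δ * ((1 - kernelRatio z w) * density lam z w)) ∂(v n) :=
      integral_mono_ae hgP (((hgi.indicator hSm).const_mul C).add (hki.const_mul _)) hpt
    _ = C * ∫ x in S, ‖f x - a‖ ^ 2 ∂(v n) + 4 * M ^ 2 / δ * (n / lam) := by
      rw [integral_add ((hgi.indicator hSm).const_mul C) (hki.const_mul _), integral_const_mul,
        integral_const_mul, integral_indicator hSm,
        integral_one_sub_kernelRatio_mul_density hlam hz]
    _ ≤ C * ((v n).real (bergmanBall z ρ) * A2 f ρ z) + 4 * M ^ 2 / δ * (n / lam) := by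
      rw [← hE]; gcongr
    _ ≤ _ := by
      rw [← mul_assoc]
      have := mul_le_mul_of_nonneg_right hCE (A2_nonneg f ρ z)
      linarith

end UnitBall

end

/-! ### Conclusion: choice of the scale `ρ = R / √lam` -/

theorem theorem4p4 (n : ℕ) (hn : 1 ≤ n) (f : UnitBall.Cn n → ℂ) (hf : f ∈ UnitBall.VMO n) :
    Tendsto (fun lam : ℝ => UnitBall.bmoSeminorm lam f) atTop (𝓝 0) := by
  open UnitBall in
  obtain ⟨hfm, hA2⟩ := hf
  set M : ℝ := (eLpNorm f ⊤ (v n)).toReal with hMdef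
  have hM0 : 0 ≤ M := ENNReal.toReal_nonneg
  have hM : ∀ᵐ x ∂(v n), ‖f x‖ ≤ M := by
    have hne : eLpNorm f ⊤ (v n) ≠ ⊤ := hfm.2.ne
    filter_upwards [ae_le_eLpNormEssSup (f := f) (μ := v n)] with x hx
    rw [← eLpNorm_exponent_top] at hx
    have := ENNReal.toReal_mono hne hx
    rwa [toReal_enorm] at this
  rw [ENNReal.tendsto_nhds_zero]
  intro ε hε
  obtain ⟨r, hr0, hrε⟩ : ∃ r : ℝ, 0 < r ∧ ENNReal.ofReal r ≤ ε := by
    rcases eq_or_ne ε ⊤ with rfl | hε'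
    · exact ⟨1, one_pos, le_top⟩
    · exact ⟨ε.toReal, ENNReal.toReal_pos hε.ne' hε', (ENNReal.ofReal_toReal hε').le⟩
  have hn1 : (0 : ℝ) < n := by exact_mod_cast hn
  -- `R` is the radius, on the scale `1 / √lam`, beyond which the mass is negligible.
  obtain ⟨R, hR0, hR⟩ : ∃ R : ℝ, 0 < R ∧
      4 * M ^ 2 * (116 * ((n : ℝ) + 1)) * n / R ^ 2 ≤ r ^ 2 / 2 := by
    -- The summand `1` keeps `R` positive even when `M = 0`.
    refine ⟨Real.sqrt (2 * (4 * M ^ 2 * (116 * ((n : ℝ) + 1)) * n) / r ^ 2 + 1), by positivity, ?_⟩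
    rw [Real.sq_sqrt (by positivity), div_le_iff₀ (by positivity)]
    have : r ^ 2 / 2 * (2 * (4 * M ^ 2 * (116 * ((n : ℝ) + 1)) * n) / r ^ 2 + 1) =
        4 * M ^ 2 * (116 * ((n : ℝ) + 1)) * n + r ^ 2 / 2 := by field_simp
    rw [this]
    have : 0 < r ^ 2 / 2 := by positivity
    linarith
  -- Since `lam * ρ ^ 2 = R ^ 2`, the factor in front of `A2` does not depend on `lam`; oscillation
  -- below `κ` then makes the near term at most `r ^ 2 / 2`.
  set κ : ℝ := r ^ 2 / 2 / (9 ^ (n + 1) * Real.exp (R ^ 2)) with hκ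
  have hκ0 : 0 < κ := by positivity
  have hρlim : Tendsto (fun lam : ℝ => R / Real.sqrt lam) atTop (𝓝[>] 0) := by
    refine tendsto_nhdsWithin_iff.2 ⟨tendsto_const_nhds.div_atTop Real.tendsto_sqrt_atTop, ?_⟩
    filter_upwards [eventually_gt_atTop 0] with lam hl
    exact div_pos hR0 (Real.sqrt_pos.2 hl)
  have hev := hρlim.eventually (Metric.tendstoUniformlyOn_iff.1 hA2 κ hκ0)
  have hsmall : ∀ᶠ lam : ℝ in atTop, R / Real.sqrt lam ≤ 1 / 2 :=
    (hρlim.mono_right nhdsWithin_le_nhds).eventually (ge_mem_nhds (by norm_num))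
  filter_upwards [hev, hsmall, eventually_gt_atTop (genus n), eventually_gt_atTop 0]
    with lam hA hle hg hl
  refine iSup₂_le fun z hz => (ENNReal.ofReal_le_ofReal ?_).trans hrε
  rw [Real.sqrt_le_left hr0.le]
  have hρ0 : 0 < R / Real.sqrt lam := div_pos hR0 (Real.sqrt_pos.2 hl)
  have hmain := MO_le_A2_add hg hρ0 hle hz hfm.1 hM0 hM
  have hρ2 : (R / Real.sqrt lam) ^ 2 = R ^ 2 / lam := by rw [div_pow, Real.sq_sqrt hl.le]
  have hA' := hA z hz
  rw [dist_zero_left, Real.norm_of_nonneg (A2_nonneg _ _ _)] at hA'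
  rw [hρ2, mul_div_cancel₀ _ hl.ne'] at hmain
  have h1 : 9 ^ (n + 1) * Real.exp (R ^ 2) * A2 f (R / Real.sqrt lam) z ≤ r ^ 2 / 2 := by
    rw [hκ, lt_div_iff₀ (by positivity)] at hA'
    linarith
  have h2 : 4 * M ^ 2 / (R ^ 2 / lam / (116 * ((n : ℝ) + 1))) * (n / lam) =
      4 * M ^ 2 * (116 * ((n : ℝ) + 1)) * n / R ^ 2 := by
    field_simp
  rw [h2] at hmain
  linarith
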